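/- Let $q\ge 1$ and $n\ge 0$ be integers, $d=q^n$, $\omega=e^{2\pi i/q}$, $\tau=-e^{\pi i/q}$. On $\mathbb{C}^q$ with basis $|k\rangle$, $k\in\mathbb{Z}_q=\{0,\dots,q-1\}$, let $X|k\rangle=|k+1\rangle$ (addition modulo $q$), $Z|k\rangle=\omega^k|k\rangle$, and $D_{(a_1,a_2)}=\tau^{a_1a_2}X^{a_1}Z^{a_2}$ for $a_1,a_2\in\{0,\dots,q-1\}$. On $n$ qudits of local dimension $q$, that is, on $(\mathbb{C}^q)^{\otimes n}\cong\mathbb{C}^d$, let $D_{\mathbf a}=D_{\mathbf a_1}\otimes\cdots\otimes D_{\mathbf a_n}$ for $\mathbf a=(\mathbf a_1,\dots,\mathbf a_n)\in(\mathbb{Z}_q\times\mathbb{Z}_q)^n$. The $\alpha$-Clifford entropy of a unitary $U\in\mathcal U(d)$ is $$H_\alpha(U)=\frac{1}{\alpha-1}\Big(1-\frac1{d^2}\sum_{\mathbf a,\mathbf b}\Big|\frac1d\operatorname{tr}\big(D_{\mathbf a}^\dagger U D_{\mathbf b}U^\dagger\big)\Big|^{2\alpha}\Big),$$ so that $H_2(U)=1-\frac1{d^6}\sum_{\mathbf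 a,\mathbf b}\big|\operatorname{tr}(D_{\mathbf a}^\dagger U D_{\mathbf b}U^\dagger)\big|^4$. Theorem. Let $\mathbb{E}_U$ be the average over $\mathcal U(d)$ with respect to the Haar probability measure. Then: (1) if $d=q^n$ with $q$ odd (in particular for a single qudit of odd dimension $d$), $$\mathbb{E}_U[H_2(U)]=1-\frac{3(d^4-4d^2+2)}{d^4(d^2-4)};$$ (2) if $n=1$ and $d=q$ is even (a single qudit of even dimension), $$\mathbb{E}_U[H_2(U)]=1-\frac{3(d^4-10d^2+10)}{d^2(d^2-9)(d^2-1)};$$ (3) if $q=2$ and $d=2^n$ ($n$ qubits), $$\mathbb{E}_U[H_2(U)]=1-\frac{4(d^4-9d^2+6)}{d^4(d^2-9)}.$$ Moreover, there is an absolute constant $C$ such that in each of these cases $\big|1-\mathbb{E}_U[H_2(U)]\big|\le C/d^2$; that is, $\mathbb{E}_U[H_2(U)]=1-O(d^{-2})$. -/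

import Mathlib

open MeasureTheory

noncomputable section

namespace CliffordEntropy

/-! ### Weyl-Heisenberg displacement operators -/

/-- The root of unity `ω = exp (2πi / d)`. -/
def omega (d : ℕ) : ℂ := Complex.exp (2 * Real.pi * Complex.I / d)

/-- The phase `τ = -exp (πi / d)`. -/
def tau (d : ℕ) : ℂ := -Complex.exp (Real.pi * Complex.I / d)

/-- The shift operator `X |k⟩ = |k + 1⟩` on `ℂ^d`, in the computational basis indexed by `ℤ/d`. -/
def shift (d : ℕ) : Matrix (ZMod d) (ZMod d) ℂ :=
  Matrix.of fun j k => if j = k + 1 then 1 else 0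

/-- The clock operator `Z |k⟩ = ω ^ k |k⟩` on `ℂ^d`. -/
def clock (d : ℕ) : Matrix (ZMod d) (ZMod d) ℂ :=
  Matrix.diagonal fun k => omega d ^ k.val

/-- The displacement operator `D_a = τ ^ (a₁ a₂) X ^ a₁ Z ^ a₂` on one qudit, where `a₁, a₂` are
represented by integers in `{0, …, d - 1}`. -/
def displacement (d : ℕ) [NeZero d] (a : ZMod d × ZMod d) : Matrix (ZMod d) (ZMod d) ℂ :=
  tau d ^ (a.1.val * a.2.val) • (shift d ^ a.1.val * clock d ^ a.2.val)

/-- The computational basis labels of `n` qudits of local dimension `q`: the Hilbert space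
`(ℂ^q)^{⊗ n}` has dimension `q ^ n`, with basis `|k₁ … kₙ⟩`, `kᵢ ∈ ℤ/q`. -/
abbrev Label (q n : ℕ) : Type := Fin n → ZMod q

/-- The composite displacement operator `D_{a₁} ⊗ ⋯ ⊗ D_{aₙ}` on `n` qudits of local dimension `q`
(the matrix entries of a tensor product are the products of the entries of the factors). -/
def multiDisplacement (q n : ℕ) [NeZero q] (a : Fin n → ZMod q × ZMod q) :
    Matrix (Label q n) (Label q n) ℂ :=
  Matrix.of fun j k => ∏ i, displacement q (a i) (j i) (k i)

/-! ### The Clifford entropy -/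

/-- The characteristic function `𝔠_{ab}(U) = (1 / d) tr (D_a† U D_b U†)` of the channel of `U`, with
`d = q ^ n`. -/
def charFun (q n : ℕ) [NeZero q] (U : Matrix.unitaryGroup (Label q n) ℂ)
    (a b : Fin n → ZMod q × ZMod q) : ℂ :=
  (1 / ((q ^ n : ℕ) : ℂ)) *
    ((multiDisplacement q n a).conjTranspose * (U : Matrix (Label q n) (Label q n) ℂ) *
      multiDisplacement q n b *
      (U : Matrix (Label q n) (Label q n) ℂ).conjTranspose).trace

/-- The `α`-Clifford entropy
`H_α(U) = (1 / (α - 1)) (1 - (1 / d²) ∑_{a, b} (|𝔠_{ab}(U)|²) ^ α)`, with `d = q ^ n`. -/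
def entropy (q n : ℕ) [NeZero q] (α : ℝ) (U : Matrix.unitaryGroup (Label q n) ℂ) : ℝ :=
  (1 / (α - 1)) *
    (1 - (1 / ((q ^ n : ℕ) : ℝ) ^ 2) * ∑ a, ∑ b, (‖charFun q n U a b‖ ^ 2) ^ α)

/-! ### Haar measure on the unitary group -/

section Haar

variable {m : Type*} [Fintype m] [DecidableEq m]

theorem isCompact_unitaryGroup : IsCompact (Matrix.unitaryGroup m ℂ : Set (Matrix m m ℂ)) := by
  have hK : IsCompact (Set.univ.pi fun _ : m => Set.univ.pi fun _ : m =>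
      Metric.closedBall (0 : ℂ) 1) :=
    isCompact_univ_pi fun _ => isCompact_univ_pi fun _ => isCompact_closedBall _ _
  refine IsCompact.of_isClosed_subset hK ?_ ?_
  · have h : (Matrix.unitaryGroup m ℂ : Set (Matrix m m ℂ)) = {A | A * star A = 1} := by
      ext A
      exact Matrix.mem_unitaryGroup_iff
    rw [h]
    exact isClosed_eq (by fun_prop) continuous_const
  · intro A hA i _ j _
    simpa using entry_norm_bound_of_unitary hA i j

instance : CompactSpace (Matrix.unitaryGroup m ℂ) :=
  isCompact_iff_compactSpace.mp isCompact_unitaryGroup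

instance : MeasurableSpace (Matrix.unitaryGroup m ℂ) := borel _

instance : BorelSpace (Matrix.unitaryGroup m ℂ) := ⟨rfl⟩

variable (m) in
/-- The Haar measure of the compact unitary group, normalized to total mass one. -/
def haarProb : Measure (Matrix.unitaryGroup m ℂ) := Measure.haarMeasure ⊤

end Haar

/-- The Haar average `𝔼_U[H₂(U)]` of the `2`-Clifford entropy over the unitary group of
`(ℂ^q)^{⊗ n}`. -/
def haarAverage (q n : ℕ) [NeZero q] : ℝ :=
  ∫ U : Matrix.unitaryGroup (Label q n) ℂ, entropy q n 2 U ∂(haarProb (Label q n))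

end CliffordEntropy

end

/-! Expanding `entropy` at `α = 2` reduces the average to the fourth moments of `|tr (D_a† U D_b
U†)|` over pairs of labels (`haarAverage_eq_sum`). Such a moment is the trace of a fixed fourfold
tensor product against the Haar average of `U B U† ⊗ U B U† ⊗ U B† U† ⊗ U B† U†`, with `B = D_b`. By
invariance this average commutes with every `V ⊗ V ⊗ V ⊗ V`, so Schur-Weyl duality
(`eq_zero_of_commute_of_trace_eq_zero`) makes any combination of permutation operators with the
right traces against permutations equal to it (`avgTens_eq`). No inverse of the Gram matrix is
needed: one solution of the linear system is enough, even in small dimensions, where the permutation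
operators are dependent.

For a nonzero label `D_a` is unitary and traceless, and `|tr D_a²|²` is `d²` if `2a = 0` and `0`
otherwise. Traces against permutations then depend only on the orbit of the permutation under
conjugation by the stabilizer of the pairing `{0,1}, {2,3}`. There are eight orbits, so the system
over the 24 permutations shrinks to eight equations, solved explicitly by `coeffGeneric` and
`coeffInvolutive`. The moment therefore depends only on whether `2a` and `2b` vanish, and the
average only on `d` and on the number `t` of labels of order two (`haarAverage_eq`): `t = 0` for odd
`q`, `t = 3` for one qudit of even dimension, `t = d² - 1` for qubits. -/

noncomputable section

namespace CliffordEntropy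

open Equiv (Perm swap)
open scoped ComplexOrder

set_option linter.unusedSectionVars false

/-! ### Tensor products of matrices and permutations of the tensor factors. -/

section TensorPower

variable {κ ι : Type*} [Fintype κ] [DecidableEq κ] [Fintype ι] [DecidableEq ι]

/-- The tensor product of a family of matrices. -/
def tens (A : κ → Matrix ι ι ℂ) : Matrix (κ → ι) (κ → ι) ℂ :=
  Matrix.of fun i j => ∏ k, A k (i k) (j k)

/-- The operator permuting the tensor factors according to `σ`. -/
def permOp (ι : Type*) [DecidableEq ι] (σ : Perm κ) : Matrix (κ → ι) (κ → ι) ℂ :=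
  Matrix.of fun i j => if i = j ∘ σ then 1 else 0

theorem tens_apply (A : κ → Matrix ι ι ℂ) (i j : κ → ι) :
    tens A i j = ∏ k, A k (i k) (j k) := rfl

theorem tens_mul (A B : κ → Matrix ι ι ℂ) : tens A * tens B = tens fun k => A k * B k := by
  ext i j
  simp only [Matrix.mul_apply, tens_apply, Finset.prod_univ_sum, Fintype.piFinset_univ,
    Finset.prod_mul_distrib]

theorem tens_one : tens (fun _ : κ => (1 : Matrix ι ι ℂ)) = 1 := by
  ext i j
  simp only [tens_apply, Matrix.one_apply, Finset.prod_ite_zero, Finset.prod_const_one,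
    Finset.mem_univ, true_imp_iff, funext_iff]

theorem tens_conjTranspose (A : κ → Matrix ι ι ℂ) :
    (tens A).conjTranspose = tens fun k => (A k).conjTranspose := by
  ext i j
  simp [tens_apply, Matrix.conjTranspose_apply]

theorem trace_tens (A : κ → Matrix ι ι ℂ) : (tens A).trace = ∏ k, (A k).trace := by
  simp only [Matrix.trace, Matrix.diag, tens_apply, Finset.prod_univ_sum, Fintype.piFinset_univ]

theorem permOp_mul_apply (σ : Perm κ) (X : Matrix (κ → ι) (κ → ι) ℂ) (i j : κ → ι) :
    (permOp ι σ * X) i j = X (i ∘ ⇑σ⁻¹) j := by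
  rw [Matrix.mul_apply, Finset.sum_eq_single (i ∘ ⇑σ⁻¹)]
  · have : i = (i ∘ ⇑σ⁻¹) ∘ σ := by ext; simp
    simp only [permOp, Matrix.of_apply, if_pos this, one_mul]
  · intro l _ hl
    have : i ≠ l ∘ σ := fun h => hl (by ext; simp [h])
    simp [permOp, this]
  · simp

theorem mul_permOp_apply (σ : Perm κ) (X : Matrix (κ → ι) (κ → ι) ℂ) (i j : κ → ι) :
    (X * permOp ι σ) i j = X i (j ∘ σ) := by
  simp [Matrix.mul_apply, permOp]

/-- Precomposition is a right action, hence the reversed order of the product. -/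
theorem permOp_mul (σ τ : Perm κ) : permOp ι σ * permOp ι τ = permOp ι (τ * σ) := by
  ext i j
  rw [mul_permOp_apply]
  rfl

theorem permOp_conjTranspose (σ : Perm κ) :
    (permOp ι σ).conjTranspose = permOp ι σ⁻¹ := by
  ext i j
  have : (j = i ∘ σ) ↔ (i = j ∘ ⇑σ⁻¹) := by
    constructor <;> rintro rfl <;> ext <;> simp
  simp [permOp, Matrix.conjTranspose_apply, this, apply_ite]

theorem permOp_one : permOp ι (1 : Perm κ) = 1 := by
  ext i j
  simp [permOp, Matrix.one_apply]

theorem tens_mul_permOp (A : Matrix ι ι ℂ) (σ : Perm κ) :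
    tens (fun _ : κ => A) * permOp ι σ = permOp ι σ * tens fun _ : κ => A := by
  ext i j
  rw [mul_permOp_apply, permOp_mul_apply, tens_apply, tens_apply]
  exact Fintype.prod_equiv σ _ _ (by simp)

theorem tens_single (a b : κ → ι) :
    tens (fun k => Matrix.single (a k) (b k) (1 : ℂ)) = Matrix.single a b 1 := by
  ext i j
  simp only [tens_apply, Matrix.single_apply, Finset.prod_ite_zero, Finset.prod_const_one,
    Finset.mem_univ, true_imp_iff, funext_iff, forall_and]

end TensorPower

/-! ### Polarization through the permanent. -/

section Polarization

variable {κ : Type*} [Fintype κ] [DecidableEq κ]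

/-- Toggling a fixed element outside `S` is a sign-reversing involution on the supersets of `S`, so
only `S = univ` leaves a term. -/
theorem sum_neg_one_pow_card_of_subset (S : Finset κ) :
    ∑ T : Finset κ, (if S ⊆ T then (-1 : ℂ) ^ T.card else 0)
      = if S = Finset.univ then (-1 : ℂ) ^ Fintype.card κ else 0 := by
  split_ifs with h
  · subst h
    rw [Finset.sum_eq_single Finset.univ] <;> simp +contextual [Finset.univ_subset_iff]
  · obtain ⟨a, ha⟩ : ∃ a, a ∉ S := by simpa [Finset.eq_univ_iff_forall] using h
    refine Finset.sum_involution (fun T _ => symmDiff T {a}) ?_ ?_ (fun _ _ => Finset.mem_univ _) ?_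
    · intro T _
      by_cases hT : a ∈ T
      · have e : symmDiff T {a} = T.erase a := by
          ext x; by_cases hx : x = a <;> simp [Finset.mem_symmDiff, hx, hT]
        have hs : S ⊆ T.erase a ↔ S ⊆ T := by
          simp [Finset.subset_erase, ha]
        have hc : T.card = (T.erase a).card + 1 := (Finset.card_erase_add_one hT).symm
        rw [e]; simp only [hs, hc]
        split_ifs <;> ring
      · have e : symmDiff T {a} = insert a T := by
          ext x; by_cases hx : x = a <;> simp [Finset.mem_symmDiff, hx, hT]
        have hs : S ⊆ insert a T ↔ S ⊆ T := Finset.subset_insert_iff_of_notMem ha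
        have hc : (insert a T).card = T.card + 1 := Finset.card_insert_of_notMem hT
        rw [e]; simp only [hs, hc]
        split_ifs <;> ring
    · intro T _ _ h
      have := congrArg (a ∈ ·) h
      simp [Finset.mem_symmDiff] at this
    · intro T _
      simp

/-- Ryser's formula for the permanent. -/
theorem sum_prod_perm_eq (f : κ → κ → ℂ) :
    ∑ σ : Perm κ, ∏ k, f k (σ k)
      = (-1) ^ Fintype.card κ * ∑ T : Finset κ, (-1) ^ T.card * ∏ k, ∑ a ∈ T, f k a := by
  -- The expanded product runs over the functions `g` with image inside `T`. The signed sum over `T`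
  -- then kills every `g` that is not surjective, and the surjective ones are the permutations.
  have h1 : ∀ T : Finset κ, (-1 : ℂ) ^ T.card * ∏ k, ∑ a ∈ T, f k a
      = ∑ g : κ → κ, (if Finset.univ.image g ⊆ T then (-1 : ℂ) ^ T.card else 0)
          * ∏ k, f k (g k) := by
    intro T
    rw [← Finset.sum_prod_piFinset, Finset.mul_sum, ← Finset.sum_filter_add_sum_filter_not
      Finset.univ (fun g : κ → κ => Finset.univ.image g ⊆ T), Finset.sum_eq_zero (s := {x | ¬ _}),
      add_zero]
    · refine Finset.sum_congr ?_ ?_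
      · ext g; simp [Finset.subset_iff]
      · intro g hg
        have : Finset.univ.image g ⊆ T := by
          rw [Finset.image_subset_iff]
          intro x _; simp [Finset.subset_iff] at hg; exact hg x
        simp [this]
    · intro g hg
      have : ¬ Finset.univ.image g ⊆ T := (Finset.mem_filter.mp hg).2
      simp only [if_neg this, zero_mul]
  simp only [h1]
  rw [Finset.sum_comm, Finset.mul_sum]
  simp_rw [← Finset.sum_mul, sum_neg_one_pow_card_of_subset, ite_mul, zero_mul, mul_ite, mul_zero]
  rw [← Finset.sum_filter]
  refine Finset.sum_bij (fun σ _ => ⇑σ) ?_ ?_ ?_ ?_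
  · intro σ _
    simp only [Finset.mem_filter, Finset.mem_univ, true_and]
    exact Finset.image_univ_of_surjective σ.surjective
  · intro σ _ τ _ h
    exact DFunLike.coe_injective h
  · intro g hg
    have hs : Function.Surjective g := by
      intro x
      have := (Finset.mem_filter.mp hg).2
      have hx : x ∈ Finset.univ.image g := by rw [this]; simp
      simpa using hx
    exact ⟨Equiv.ofBijective g (Finite.surjective_iff_bijective.mp hs), Finset.mem_univ _, rfl⟩
  · intro σ _
    rw [← mul_assoc, ← mul_pow]; simp

end Polarization

/-! ### Schur-Weyl duality, by a frame-operator argument. -/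

section SchurWeyl

variable {κ ι : Type*} [Fintype κ] [DecidableEq κ] [Fintype ι] [DecidableEq ι]

/-- The elementary matrices, symmetrized over the permutations of the tensor factors. -/
def symSingle (a b : κ → ι) : Matrix (κ → ι) (κ → ι) ℂ :=
  ∑ σ : Perm κ, Matrix.single (a ∘ σ) (b ∘ σ) 1

/-- Each entry of `symSingle a b` is a permanent, so Ryser's formula puts it in the span of the
tensor powers. Whatever commutes with all tensor powers thus commutes with it. -/
theorem symSingle_eq (a b : κ → ι) :
    symSingle a b = (-1 : ℂ) ^ Fintype.card κ • ∑ T : Finset κ, (-1 : ℂ) ^ T.card •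
      tens fun _ : κ => ∑ l ∈ T, Matrix.single (a l) (b l) (1 : ℂ) := by
  have h : symSingle a b = ∑ σ : Perm κ,
      tens fun k => Matrix.single (a (σ k)) (b (σ k)) (1 : ℂ) := by
    refine Finset.sum_congr rfl fun σ _ => ?_
    rw [← tens_single]; rfl
  ext i j
  rw [h]
  simp only [Matrix.sum_apply, Matrix.smul_apply, tens_apply, smul_eq_mul]
  exact sum_prod_perm_eq fun k l => Matrix.single (a l) (b l) (1 : ℂ) (i k) (j k)

theorem commute_symSingle {N : Matrix (κ → ι) (κ → ι) ℂ}
    (hN : ∀ A : Matrix ι ι ℂ, Commute N (tens fun _ => A)) (a b : κ → ι) :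
    Commute N (symSingle a b) := by
  rw [symSingle_eq]
  exact ((Commute.sum_right _ _ _ fun T _ => (hN _).smul_right _)).smul_right _

/-- The frame operator of the permutation operators. -/
def permFrame (X : Matrix (κ → ι) (κ → ι) ℂ) : Matrix (κ → ι) (κ → ι) ℂ :=
  ∑ σ : Perm κ, (permOp ι σ⁻¹ * X).trace • permOp ι σ

/-- In this form every left factor is a symmetrized elementary matrix, which an operator `N` in the
commutant can be moved past; this makes `permFrame` linear over the commutant. -/
theorem permFrame_eq (X : Matrix (κ → ι) (κ → ι) ℂ) :
    permFrame X = ∑ a : κ → ι, ∑ b : κ → ι, symSingle a b * X * Matrix.single b a 1 := by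
  simp only [symSingle, Finset.sum_mul, Matrix.single_mul_mul_single, one_mul, mul_one]
  ext i j
  simp only [permFrame, Matrix.sum_apply, Matrix.smul_apply, Matrix.trace, Matrix.diag,
    permOp_mul_apply, Matrix.single_apply, smul_eq_mul, inv_inv]
  simp only [ite_and]
  conv_rhs => rw [Finset.sum_comm]
  conv_rhs => enter [2, b]; rw [Finset.sum_comm]
  conv_rhs => rw [Finset.sum_comm]
  refine Finset.sum_congr rfl fun σ _ => ?_
  rw [Finset.sum_mul]
  refine Finset.sum_congr rfl fun b _ => ?_
  rw [Finset.sum_eq_single j]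
  · simp [permOp, eq_comm]
  · intro a _ ha
    simp [ha]
  · simp

theorem permFrame_mul {N : Matrix (κ → ι) (κ → ι) ℂ}
    (hN : ∀ A : Matrix ι ι ℂ, Commute N (tens fun _ => A)) (X : Matrix (κ → ι) (κ → ι) ℂ) :
    permFrame (N * X) = N * permFrame X := by
  simp only [permFrame_eq, Finset.mul_sum]
  refine Finset.sum_congr rfl fun a _ => Finset.sum_congr rfl fun b _ => ?_
  rw [← mul_assoc (symSingle a b), ← (commute_symSingle hN a b).eq]
  simp only [mul_assoc]

/-- If the columns of `B` are the permutation operators, then `permFrame` is `B * Bᴴ`. This has the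
same rank as `B`, hence the same range, which contains the identity permutation operator. -/
theorem exists_permFrame_eq_one : ∃ X : Matrix (κ → ι) (κ → ι) ℂ, permFrame X = 1 := by
  let B : Matrix ((κ → ι) × (κ → ι)) (Perm κ) ℂ := Matrix.of fun p σ => permOp ι σ p.1 p.2
  have hle : LinearMap.range (B * B.conjTranspose).mulVecLin ≤ LinearMap.range B.mulVecLin := by
    rw [Matrix.mulVecLin_mul]; exact LinearMap.range_comp_le_range _ _
  have heq := Submodule.eq_of_le_of_finrank_eq hle (Matrix.rank_self_mul_conjTranspose B)
  have hmem : B.mulVecLin (Pi.single 1 1) ∈ LinearMap.range (B * B.conjTranspose).mulVecLin := by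
    rw [heq]; exact ⟨_, rfl⟩
  obtain ⟨v, hv⟩ := hmem
  refine ⟨Matrix.of fun i j => v (i, j), ?_⟩
  ext i j
  have h := congrFun hv (i, j)
  have h1 : (B.mulVecLin (Pi.single 1 1)) (i, j) = (1 : Matrix (κ → ι) (κ → ι) ℂ) i j := by
    simp only [Matrix.mulVecLin_apply, Matrix.mulVec_single_one, ← permOp_one]
    rfl
  rw [← h1, ← h, Matrix.mulVecLin_apply, ← Matrix.mulVec_mulVec]
  simp only [permFrame, Matrix.sum_apply, Matrix.smul_apply, Matrix.mulVec, dotProduct, B,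
    Matrix.of_apply, Matrix.conjTranspose_apply, smul_eq_mul]
  refine Finset.sum_congr rfl fun σ _ => ?_
  rw [mul_comm]
  congr 1
  rw [Fintype.sum_prod_type, Finset.sum_comm]
  simp only [Matrix.trace, Matrix.diag, Matrix.mul_apply, Matrix.of_apply]
  refine Finset.sum_congr rfl fun a _ => Finset.sum_congr rfl fun b _ => ?_
  rw [← permOp_conjTranspose, Matrix.conjTranspose_apply]

/-- Schur-Weyl duality: an operator that commutes with all tensor powers and is orthogonal to
all permutations of the tensor factors vanishes. -/
theorem eq_zero_of_commute_of_trace_eq_zero {N : Matrix (κ → ι) (κ → ι) ℂ}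
    (hN : ∀ A : Matrix ι ι ℂ, Commute N (tens fun _ => A))
    (h0 : ∀ σ : Perm κ, (permOp ι σ * N).trace = 0) : N = 0 := by
  obtain ⟨X, hX⟩ := exists_permFrame_eq_one (κ := κ) (ι := ι)
  -- As `permFrame X = 1`, this writes `N` as a combination of permutation operators. Since `N` is
  -- orthogonal to all of them, `tr (Nᴴ N) = 0`.
  have h := permFrame_mul hN X
  rw [hX, mul_one] at h
  rw [← Matrix.trace_conjTranspose_mul_self_eq_zero_iff]
  nth_rewrite 1 [← h]
  simp [permFrame, Matrix.conjTranspose_sum, Matrix.conjTranspose_smul, permOp_conjTranspose,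
    Finset.sum_mul, Matrix.trace_sum, h0]

/-! ### From unitary to arbitrary matrices -/

theorem tens_diagonal (z : ι → ℂ) :
    tens (fun _ : κ => Matrix.diagonal z) = Matrix.diagonal fun i => ∏ k, z (i k) := by
  ext i j
  simp only [tens_apply, Matrix.diagonal_apply, Finset.prod_ite_zero, Finset.mem_univ,
    true_imp_iff, funext_iff]

theorem commute_diagonal_iff {m : Type*} [Fintype m] [DecidableEq m] (N : Matrix m m ℂ)
    (z : m → ℂ) : Commute N (Matrix.diagonal z) ↔ ∀ i j, N i j ≠ 0 → z i = z j := by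
  rw [commute_iff_eq, ← Matrix.ext_iff]
  simp only [Matrix.mul_diagonal, Matrix.diagonal_mul]
  refine forall₂_congr fun i j => ?_
  rw [mul_comm (z i), ← sub_eq_zero, ← mul_sub, mul_eq_zero, sub_eq_zero, or_iff_not_imp_left,
    @eq_comm _ (z i)]

theorem prod_update_one (i : κ → ι) (a : ι) (w : ℂ) :
    ∏ k, Function.update (1 : ι → ℂ) a w (i k) = w ^ (Finset.univ.filter fun k => i k = a).card := by
  simp [Function.update_apply, Finset.prod_ite]

/-- A nonzero entry `N i j` should force `i` and `j` to take each value equally often, since the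
diagonal entries of the tensor power depend only on these multiplicities. Unitary diagonal matrices
already detect them. -/
theorem commute_tens_diagonal {N : Matrix (κ → ι) (κ → ι) ℂ}
    (hN : ∀ U ∈ Matrix.unitaryGroup ι ℂ, Commute N (tens fun _ => U)) (z : ι → ℂ) :
    Commute N (tens fun _ => Matrix.diagonal z) := by
  rw [tens_diagonal, commute_diagonal_iff]
  intro i j hij
  have key : ∀ a, (Finset.univ.filter fun k => i k = a).card
      = (Finset.univ.filter fun k => j k = a).card := by
    intro a
    -- Multiplicities lie between `0` and `card κ`, so a primitive root of unity of order `card κ +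
    -- 1`, placed at `a`, separates them.
    have hn : (Fintype.card κ + 1) ≠ 0 := by omega
    have hζ := Complex.isPrimitiveRoot_exp _ hn
    set w := Complex.exp (2 * Real.pi * Complex.I / ((Fintype.card κ + 1 : ℕ) : ℂ)) with hw
    have hnorm : ‖w‖ = 1 := hζ.norm'_eq_one hn
    have hU : Matrix.diagonal (Function.update (1 : ι → ℂ) a w) ∈ Matrix.unitaryGroup ι ℂ := by
      rw [Matrix.mem_unitaryGroup_iff, Matrix.star_eq_conjTranspose,
        Matrix.diagonal_conjTranspose, Matrix.diagonal_mul_diagonal, ← Matrix.diagonal_one]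
      congr 1
      ext b
      by_cases hb : b = a
      · subst hb
        simp [Complex.mul_conj, Complex.normSq_eq_norm_sq, hnorm]
      · simp [hb]
    have h := hN _ hU
    rw [tens_diagonal, commute_diagonal_iff] at h
    have h2 := h i j hij
    rw [prod_update_one, prod_update_one] at h2
    exact hζ.pow_inj (Nat.lt_succ_of_le (Finset.card_le_univ _))
      (Nat.lt_succ_of_le (Finset.card_le_univ _)) h2
  have hprod : ∀ l : κ → ι, ∏ k, z (l k)
      = ∏ a, z a ^ (Finset.univ.filter fun k => l k = a).card := by
    intro l
    rw [← Finset.prod_fiberwise Finset.univ l]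
    refine Finset.prod_congr rfl fun a _ => ?_
    rw [← Finset.prod_const]
    exact Finset.prod_congr rfl fun k hk => by rw [(Finset.mem_filter.mp hk).2]
  rw [hprod, hprod]
  simp only [key]

/-- Singular value decomposition from the spectral theorem for `Aᴴ A`; invertibility makes the
singular values nonzero, so that `A V diag(1/s)` is unitary. -/
theorem exists_unitary_diagonal {A : Matrix ι ι ℂ} (hA : IsUnit A) :
    ∃ U ∈ Matrix.unitaryGroup ι ℂ, ∃ V ∈ Matrix.unitaryGroup ι ℂ, ∃ z : ι → ℂ,
      A = U * Matrix.diagonal z * V := by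
  have hpd : (A.conjTranspose * A).PosDef :=
    Matrix.PosDef.conjTranspose_mul_self A (Matrix.mulVec_injective_of_isUnit hA)
  have hH := hpd.isHermitian
  set V := hH.eigenvectorUnitary with hV
  let s : ι → ℂ := fun i => (Real.sqrt (hH.eigenvalues i) : ℂ)
  have hs : ∀ i, s i ≠ 0 := fun i => by
    simpa [s] using (Real.sqrt_pos.mpr (hpd.eigenvalues_pos i)).ne'
  have hspec : (V : Matrix ι ι ℂ).conjTranspose * (A.conjTranspose * A) * V
      = Matrix.diagonal fun i => (hH.eigenvalues i : ℂ) := by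
    have := hH.conjStarAlgAut_star_eigenvectorUnitary
    rw [Unitary.conjStarAlgAut_apply] at this
    simpa [Matrix.star_eq_conjTranspose, Function.comp_def] using this
  have hVV : (V : Matrix ι ι ℂ) * (V : Matrix ι ι ℂ).conjTranspose = 1 :=
    Matrix.mem_unitaryGroup_iff.mp V.2
  refine ⟨A * V * Matrix.diagonal fun i => (s i)⁻¹, ?_, (V : Matrix ι ι ℂ).conjTranspose, ?_, s, ?_⟩
  · rw [Matrix.mem_unitaryGroup_iff', Matrix.star_eq_conjTranspose]
    simp only [Matrix.conjTranspose_mul, Matrix.diagonal_conjTranspose]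
    have : ∀ D D' : Matrix ι ι ℂ, D * ((V : Matrix ι ι ℂ).conjTranspose * A.conjTranspose) *
        (A * V * D') = D * ((V : Matrix ι ι ℂ).conjTranspose * (A.conjTranspose * A) * V) * D' := by
      intro D D'; simp only [mul_assoc]
    rw [this, hspec, Matrix.diagonal_mul_diagonal, Matrix.diagonal_mul_diagonal,
      ← Matrix.diagonal_one]
    congr 1
    ext i
    have h2 : (hH.eigenvalues i : ℂ) = s i * s i := by
      rw [← Complex.ofReal_mul, Real.mul_self_sqrt (hpd.eigenvalues_pos i).le]
    have h3 : star (s i) = s i := Complex.conj_ofReal _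
    simp only [Pi.star_apply, star_inv₀, h3, h2]
    field_simp [hs i]
  · exact (star V).2
  · rw [mul_assoc (A * (V : Matrix ι ι ℂ)), Matrix.diagonal_mul_diagonal]
    simp [hs, mul_assoc, hVV]

theorem commute_tens_of_isUnit {N : Matrix (κ → ι) (κ → ι) ℂ}
    (hN : ∀ U ∈ Matrix.unitaryGroup ι ℂ, Commute N (tens fun _ => U)) {A : Matrix ι ι ℂ}
    (hA : IsUnit A) : Commute N (tens fun _ => A) := by
  obtain ⟨U, hU, V, hV, z, rfl⟩ := exists_unitary_diagonal hA
  rw [← tens_mul (fun _ => U * Matrix.diagonal z) (fun _ => V),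
    ← tens_mul (fun _ => U) (fun _ => Matrix.diagonal z)]
  exact ((hN U hU).mul_right (commute_tens_diagonal hN z)).mul_right (hN V hV)

/-- Density: `t - A` is invertible off the finite spectrum of `A`, and commuting is a closed
condition in `t`. At `t = 0` the tensor power is that of `-A`, which differs only by a sign. -/
theorem commute_tens {N : Matrix (κ → ι) (κ → ι) ℂ}
    (hN : ∀ U ∈ Matrix.unitaryGroup ι ℂ, Commute N (tens fun _ => U)) (A : Matrix ι ι ℂ) :
    Commute N (tens fun _ => A) := by
  have hfin : (spectrum ℂ A).Finite := Matrix.finite_spectrum A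
  have hd : Dense (spectrum ℂ A)ᶜ := hfin.countable.dense_compl ℂ
  have hc : Continuous fun t : ℂ => tens fun _ : κ => algebraMap ℂ (Matrix ι ι ℂ) t - A := by
    refine continuous_pi fun i => continuous_pi fun j => ?_
    simp only [tens_apply, Matrix.sub_apply, Matrix.algebraMap_matrix_apply]
    refine continuous_finsetProd _ fun k _ => ?_
    split_ifs <;> fun_prop
  have h := Continuous.ext_on hd (f := fun t : ℂ => N * tens fun _ : κ =>
      algebraMap ℂ (Matrix ι ι ℂ) t - A) (g := fun t : ℂ => (tens fun _ : κ =>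
      algebraMap ℂ (Matrix ι ι ℂ) t - A) * N) (by fun_prop) (by fun_prop) (fun t ht => by
        exact commute_tens_of_isUnit hN (by simpa [spectrum.mem_iff] using ht))
  have h0 := congrFun h 0
  have hneg : (tens fun _ : κ => -A) = (-1 : ℂ) ^ Fintype.card κ • tens fun _ : κ => A := by
    ext i j
    simp [tens_apply, Finset.prod_neg]
  simp only [map_zero, zero_sub, hneg] at h0
  have h1 : (-1 : ℂ) ^ Fintype.card κ ≠ 0 := pow_ne_zero _ (by norm_num)
  rw [Matrix.mul_smul, Matrix.smul_mul] at h0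
  exact smul_right_injective _ h1 h0

end SchurWeyl

/-! ### Haar averages of conjugated tensor products. -/

section HaarMoments

variable {κ ι : Type*} [Fintype κ] [DecidableEq κ] [Fintype ι] [DecidableEq ι]

instance : IsProbabilityMeasure (haarProb ι) := ⟨Measure.haarMeasure_self⟩

instance : (haarProb ι).IsMulLeftInvariant := by
  unfold haarProb; infer_instance

theorem integrable_haarProb {f : Matrix.unitaryGroup ι ℂ → ℂ} (hf : Continuous f) :
    Integrable f (haarProb ι) :=
  hf.integrable_of_hasCompactSupport (HasCompactSupport.of_compactSpace f)

/-- The conjugation of a family of matrices by a unitary matrix, tensorized. -/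
def conjTens (B : κ → Matrix ι ι ℂ) (U : Matrix.unitaryGroup ι ℂ) :
    Matrix (κ → ι) (κ → ι) ℂ :=
  tens fun k => (U : Matrix ι ι ℂ) * B k * (U : Matrix ι ι ℂ).conjTranspose

/-- The Haar average of `conjTens B`. -/
def avgTens (B : κ → Matrix ι ι ℂ) : Matrix (κ → ι) (κ → ι) ℂ :=
  Matrix.of fun i j => ∫ U, conjTens B U i j ∂haarProb ι

theorem continuous_conjTens (B : κ → Matrix ι ι ℂ) : Continuous (conjTens B) := by
  refine continuous_pi fun i => continuous_pi fun j => ?_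
  simp only [conjTens, tens_apply]
  refine continuous_finsetProd _ fun k _ => ?_
  have : Continuous fun U : Matrix.unitaryGroup ι ℂ =>
      (U : Matrix ι ι ℂ) * B k * (U : Matrix ι ι ℂ).conjTranspose :=
    (continuous_subtype_val.mul continuous_const).mul
      (Continuous.matrix_conjTranspose continuous_subtype_val)
  exact this.matrix_elem _ _

theorem integrable_conjTens (B : κ → Matrix ι ι ℂ) (i j : κ → ι) :
    Integrable (fun U => conjTens B U i j) (haarProb ι) :=
  integrable_haarProb ((continuous_conjTens B).matrix_elem i j)

theorem mul_avgTens_mul_apply (X Y : Matrix (κ → ι) (κ → ι) ℂ) (B : κ → Matrix ι ι ℂ)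
    (i j : κ → ι) :
    (X * avgTens B * Y) i j = ∫ U, (X * conjTens B U * Y) i j ∂haarProb ι := by
  simp only [Matrix.mul_apply, avgTens, Matrix.of_apply]
  rw [integral_finsetSum]
  · refine Finset.sum_congr rfl fun b _ => ?_
    rw [integral_mul_const, integral_finsetSum]
    · simp only [integral_const_mul]
    · exact fun a _ => (integrable_conjTens B _ _).const_mul _
  · exact fun b _ => (integrable_finsetSum _ fun a _ =>
      (integrable_conjTens B _ _).const_mul _).mul_const _

theorem trace_mul_avgTens (X : Matrix (κ → ι) (κ → ι) ℂ) (B : κ → Matrix ι ι ℂ) :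
    (X * avgTens B).trace = ∫ U, (X * conjTens B U).trace ∂haarProb ι := by
  have h := fun i => mul_avgTens_mul_apply X 1 B i i
  simp only [mul_one] at h
  simp only [Matrix.trace, Matrix.diag, h]
  rw [integral_finsetSum]
  intro i _
  simp only [Matrix.mul_apply]
  exact integrable_finsetSum _ fun a _ => (integrable_conjTens B _ _).const_mul _

theorem conjTens_eq (B : κ → Matrix ι ι ℂ) (U : Matrix.unitaryGroup ι ℂ) :
    conjTens B U = tens (fun _ => (U : Matrix ι ι ℂ)) * tens B *
      (tens fun _ => (U : Matrix ι ι ℂ).conjTranspose) := by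
  rw [tens_mul, tens_mul]; rfl

theorem tens_unitary_mul (U : Matrix.unitaryGroup ι ℂ) :
    (tens fun _ : κ => (U : Matrix ι ι ℂ).conjTranspose) * (tens fun _ => (U : Matrix ι ι ℂ))
      = 1 := by
  rw [tens_mul, ← tens_one]
  have := Matrix.mem_unitaryGroup_iff'.mp U.2
  rw [Matrix.star_eq_conjTranspose] at this
  simp only [this]

/-- Conjugating the integrand by `V` replaces `U` by `V * U`, which left invariance absorbs. -/
theorem commute_avgTens (B : κ → Matrix ι ι ℂ) (V : Matrix.unitaryGroup ι ℂ) :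
    Commute (avgTens B) (tens fun _ : κ => (V : Matrix ι ι ℂ)) := by
  have h : (tens fun _ : κ => (V : Matrix ι ι ℂ)) * avgTens B *
      (tens fun _ : κ => (V : Matrix ι ι ℂ).conjTranspose) = avgTens B := by
    ext i j
    rw [mul_avgTens_mul_apply]
    have : ∀ U, (tens fun _ : κ => (V : Matrix ι ι ℂ)) * conjTens B U *
        (tens fun _ : κ => (V : Matrix ι ι ℂ).conjTranspose) = conjTens B (V * U) := by
      intro U
      simp only [conjTens, tens_mul]
      congr 1
      ext1 k
      simp [Matrix.conjTranspose_mul, mul_assoc]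
    simp only [this]
    exact integral_mul_left_eq_self (fun U => conjTens B U i j) V
  rw [commute_iff_eq]
  nth_rewrite 1 [← h]
  rw [mul_assoc, tens_unitary_mul, mul_one]

/-- The trace of `tens A` multiplied by the permutation operator of `σ`. -/
def permTrace (σ : Perm κ) (A : κ → Matrix ι ι ℂ) : ℂ :=
  ∑ i : κ → ι, ∏ k, A k (i k) (i (σ k))

theorem trace_tens_mul_permOp (σ : Perm κ) (A : κ → Matrix ι ι ℂ) :
    (tens A * permOp ι σ).trace = permTrace σ A := by
  simp only [Matrix.trace, Matrix.diag, mul_permOp_apply]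
  rfl

theorem trace_permOp_mul_permOp (σ τ : Perm κ) :
    (permOp ι σ * permOp ι τ).trace = permTrace (τ * σ) fun _ => (1 : Matrix ι ι ℂ) := by
  rw [permOp_mul, ← trace_tens_mul_permOp, tens_one, one_mul]

/-- The difference of the two sides is in the commutant, and `hc` says that it is orthogonal to all
permutation operators. No uniqueness of `c` is involved. -/
theorem avgTens_eq {B : κ → Matrix ι ι ℂ} {c : Perm κ → ℂ}
    (hc : ∀ σ, ∑ π, c π * permTrace (π * σ) (fun _ => (1 : Matrix ι ι ℂ)) = permTrace σ B) :
    avgTens B = ∑ π, c π • permOp ι π := by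
  rw [← sub_eq_zero]
  refine eq_zero_of_commute_of_trace_eq_zero ?_ ?_
  · refine commute_tens fun V hV => ?_
    refine (commute_avgTens B ⟨V, hV⟩).sub_left (Commute.sum_left _ _ _ fun π _ => ?_)
    exact Commute.smul_left (tens_mul_permOp V π).symm _
  · intro σ
    rw [Matrix.mul_sub, Matrix.trace_sub, sub_eq_zero, trace_mul_avgTens]
    -- Permutation operators commute with tensor powers, so the conjugation by `U` cancels under the
    -- trace.
    have h : ∀ U, (permOp ι σ * conjTens B U).trace = permTrace σ B := by
      intro U
      rw [conjTens_eq, ← trace_tens_mul_permOp, ← mul_assoc, ← mul_assoc, Matrix.trace_mul_comm,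
        ← mul_assoc, ← tens_mul_permOp, ← mul_assoc, tens_unitary_mul, one_mul,
        Matrix.trace_mul_comm]
    simp only [h, integral_const, probReal_univ, one_smul]
    rw [← hc, Finset.mul_sum, Matrix.trace_sum]
    refine Finset.sum_congr rfl fun π _ => ?_
    rw [Matrix.mul_smul, Matrix.trace_smul, trace_permOp_mul_permOp, smul_eq_mul]

/-- Mixed moments of the traces `tr (A_k U B_k U†)` over the unitary group. -/
theorem integral_prod_trace {A B : κ → Matrix ι ι ℂ} {c : Perm κ → ℂ}
    (hc : ∀ σ, ∑ π, c π * permTrace (π * σ) (fun _ => (1 : Matrix ι ι ℂ)) = permTrace σ B) :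
    ∫ U : Matrix.unitaryGroup ι ℂ, ∏ k, (A k * ((U : Matrix ι ι ℂ) * B k *
      (U : Matrix ι ι ℂ).conjTranspose)).trace ∂haarProb ι = ∑ π, c π * permTrace π A := by
  have h : ∀ U : Matrix.unitaryGroup ι ℂ, ∏ k, (A k * ((U : Matrix ι ι ℂ) * B k *
      (U : Matrix ι ι ℂ).conjTranspose)).trace = (tens A * conjTens B U).trace := by
    intro U
    rw [conjTens, tens_mul, trace_tens]
  simp only [h]
  rw [← trace_mul_avgTens, avgTens_eq hc, Finset.mul_sum, Matrix.trace_sum]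
  refine Finset.sum_congr rfl fun π _ => ?_
  rw [Matrix.mul_smul, Matrix.trace_smul, trace_tens_mul_permOp, smul_eq_mul]

end HaarMoments

/-! ### Four tensor factors: the eight types of permutations and the linear system. -/

section FourFold

/-- The type of a permutation of four tensor factors, of which the first two and the last two
carry the same matrix: identity, transposition inside a pair, transposition between the pairs,
3-cycle, double transposition inside the pairs, double transposition between the pairs,
4-cycle whose square preserves the
pairs, other 4-cycle. -/
def permType (σ : Perm (Fin 4)) : Fin 8 :=
  if σ 0 = 0 then
    if σ 1 = 1 then (if σ 2 = 2 then 0 else 1)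
    else if σ 2 = 2 ∨ σ 3 = 3 then 2 else 3
  else if σ 1 = 1 then (if σ 2 = 2 ∨ σ 3 = 3 then 2 else 3)
  else if σ 2 = 2 then (if σ 3 = 3 then 1 else 3)
  else if σ 3 = 3 then 3
  else if σ 0 = 1 then (if σ 1 = 0 then 4 else 7)
  else if σ (σ 0) = 0 then 5
  else if σ (σ 0) = 1 then 6 else 7

/-- The number of cycles, minus one, of the permutations of each type. -/
def cycleCount : Fin 8 → Fin 4 := ![3, 2, 2, 1, 1, 1, 0, 0]

/-- The number of permutations `π` of type `i` such that `π * σ` has `j + 1` cycles, for `σ` of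
type `s`. -/
def typeCount : Fin 8 → Fin 8 → Fin 4 → ℕ :=
  ![![![0, 0, 0, 1], ![0, 0, 2, 0], ![0, 0, 4, 0], ![0, 8, 0, 0], ![0, 1, 0, 0], ![0, 2, 0, 0], ![2, 0, 0, 0], ![4, 0, 0, 0]],
    ![![0, 0, 1, 0], ![0, 1, 0, 1], ![0, 4, 0, 0], ![4, 0, 4, 0], ![0, 0, 1, 0], ![2, 0, 0, 0], ![0, 2, 0, 0], ![0, 4, 0, 0]],
    ![![0, 0, 1, 0], ![0, 2, 0, 0], ![0, 3, 0, 1], ![4, 0, 4, 0], ![1, 0, 0, 0], ![1, 0, 1, 0], ![0, 2, 0, 0], ![0, 4, 0, 0]],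
    ![![0, 1, 0, 0], ![1, 0, 1, 0], ![2, 0, 2, 0], ![0, 7, 0, 1], ![0, 1, 0, 0], ![0, 2, 0, 0], ![1, 0, 1, 0], ![2, 0, 2, 0]],
    ![![0, 1, 0, 0], ![0, 0, 2, 0], ![4, 0, 0, 0], ![0, 8, 0, 0], ![0, 0, 0, 1], ![0, 2, 0, 0], ![2, 0, 0, 0], ![0, 0, 4, 0]],
    ![![0, 1, 0, 0], ![2, 0, 0, 0], ![2, 0, 2, 0], ![0, 8, 0, 0], ![0, 1, 0, 0], ![0, 1, 0, 1], ![0, 0, 2, 0], ![2, 0, 2, 0]],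
    ![![1, 0, 0, 0], ![0, 2, 0, 0], ![0, 4, 0, 0], ![4, 0, 4, 0], ![1, 0, 0, 0], ![0, 0, 2, 0], ![0, 1, 0, 1], ![0, 4, 0, 0]],
    ![![1, 0, 0, 0], ![0, 2, 0, 0], ![0, 4, 0, 0], ![4, 0, 4, 0], ![0, 0, 1, 0], ![1, 0, 1, 0], ![0, 2, 0, 0], ![0, 3, 0, 1]]]

/-- A permutation of each type. -/
def typeRep : Fin 8 → Perm (Fin 4) :=
  ![1, swap 0 1, swap 0 2, swap 0 1 * swap 1 2, swap 0 1 * swap 2 3, swap 0 2 * swap 1 3,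
    swap 0 2 * swap 2 1 * swap 1 3, swap 0 1 * swap 1 2 * swap 2 3]

set_option maxRecDepth 100000 in
theorem card_permType_eq : ∀ (σ : Perm (Fin 4)) (i : Fin 8) (j : Fin 4),
    (Finset.univ.filter fun π : Perm (Fin 4) =>
      permType π = i ∧ cycleCount (permType (π * σ)) = j).card = typeCount (permType σ) i j := by
  decide +kernel

set_option maxRecDepth 100000 in
-- Each type is a single orbit under conjugation by permutations that preserve or exchange the two
-- pairs, so traces need computing only at the representatives.
theorem exists_conj_typeRep : ∀ σ : Perm (Fin 4), ∃ τ : Perm (Fin 4),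
    σ = τ * typeRep (permType σ) * τ⁻¹ ∧
      ((τ 0 < 2 ∧ τ 1 < 2 ∧ 2 ≤ τ 2 ∧ 2 ≤ τ 3) ∨ (2 ≤ τ 0 ∧ 2 ≤ τ 1 ∧ τ 2 < 2 ∧ τ 3 < 2)) := by
  decide +kernel

/-- This collapses the Gram equation at `σ`, a sum over 24 permutations, to a sum over types and
cycle numbers. -/
theorem sum_permType_eq (g : Fin 8 → ℂ) (h : Fin 4 → ℂ) (σ : Perm (Fin 4)) :
    ∑ π, g (permType π) * h (cycleCount (permType (π * σ)))
      = ∑ i, ∑ j, typeCount (permType σ) i j * (g i * h j) := by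
  have := Finset.sum_fiberwise (Finset.univ : Finset (Perm (Fin 4)))
    (fun π => (permType π, cycleCount (permType (π * σ))))
    (fun π => g (permType π) * h (cycleCount (permType (π * σ))))
  rw [← this, Fintype.sum_prod_type]
  refine Finset.sum_congr rfl fun i _ => Finset.sum_congr rfl fun j _ => ?_
  rw [← card_permType_eq, ← nsmul_eq_mul, ← Finset.sum_const]
  refine Finset.sum_congr ?_ ?_
  · ext π; simp
  · intro π hπ
    simp only [Finset.mem_filter, Finset.mem_univ, true_and] at hπ
    rw [hπ.1, hπ.2]

variable {ι : Type*} [Fintype ι] [DecidableEq ι]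

theorem permTrace_conj {κ : Type*} [Fintype κ] [DecidableEq κ] (σ τ : Perm κ)
    (A : κ → Matrix ι ι ℂ) : permTrace (τ * σ * τ⁻¹) A = permTrace σ (A ∘ τ) := by
  refine Fintype.sum_equiv (Equiv.arrowCongr τ.symm (Equiv.refl ι)) _ _ fun i => ?_
  exact (Fintype.prod_equiv τ _ _ fun k => by simp).symm

theorem sum_fin_four_fun (F : (Fin 4 → ι) → ℂ) :
    ∑ i, F i = ∑ a, ∑ b, ∑ c, ∑ e, F ![a, b, c, e] := by
  simp only [← (Fin.consEquiv fun _ => ι).sum_comp, Fintype.sum_prod_type,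
    Fintype.sum_unique]
  rfl

theorem permTrace_eq_sum (σ : Perm (Fin 4)) (A : Fin 4 → Matrix ι ι ℂ) :
    permTrace σ A = ∑ a, ∑ b, ∑ c, ∑ e, A 0 a (![a, b, c, e] (σ 0)) * A 1 b (![a, b, c, e] (σ 1))
      * A 2 c (![a, b, c, e] (σ 2)) * A 3 e (![a, b, c, e] (σ 3)) := by
  simp only [permTrace, sum_fin_four_fun, Fin.prod_univ_four]
  rfl

theorem permTrace_typeRep_zero (A : Fin 4 → Matrix ι ι ℂ) :
    permTrace (typeRep 0) A = (A 0).trace * (A 1).trace * (A 2).trace * (A 3).trace := by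
  have h : typeRep 0 0 = 0 ∧ typeRep 0 1 = 1 ∧ typeRep 0 2 = 2 ∧ typeRep 0 3 = 3 := by decide
  rw [permTrace_eq_sum, h.1, h.2.1, h.2.2.1, h.2.2.2]
  simp [← Finset.mul_sum, ← Finset.sum_mul, Matrix.trace]

theorem permTrace_typeRep_one (A : Fin 4 → Matrix ι ι ℂ) :
    permTrace (typeRep 1) A = (A 0 * A 1).trace * (A 2).trace * (A 3).trace := by
  have h : typeRep 1 0 = 1 ∧ typeRep 1 1 = 0 ∧ typeRep 1 2 = 2 ∧ typeRep 1 3 = 3 := by decide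
  rw [permTrace_eq_sum, h.1, h.2.1, h.2.2.1, h.2.2.2]
  simp [← Finset.mul_sum, ← Finset.sum_mul, Matrix.trace, Matrix.mul_apply]

theorem permTrace_typeRep_three (A : Fin 4 → Matrix ι ι ℂ) :
    permTrace (typeRep 3) A = (A 0 * A 1 * A 2).trace * (A 3).trace := by
  have h : typeRep 3 0 = 1 ∧ typeRep 3 1 = 2 ∧ typeRep 3 2 = 0 ∧ typeRep 3 3 = 3 := by decide
  rw [permTrace_eq_sum, h.1, h.2.1, h.2.2.1, h.2.2.2]
  simp only [Matrix.trace, Matrix.mul_apply, Matrix.diag, Finset.sum_mul]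
  refine Finset.sum_congr rfl fun a _ => ?_
  rw [Finset.sum_comm]
  simp [← Finset.mul_sum]

theorem permTrace_typeRep_four (A : Fin 4 → Matrix ι ι ℂ) :
    permTrace (typeRep 4) A = (A 0 * A 1).trace * (A 2 * A 3).trace := by
  have h : typeRep 4 0 = 1 ∧ typeRep 4 1 = 0 ∧ typeRep 4 2 = 3 ∧ typeRep 4 3 = 2 := by decide
  rw [permTrace_eq_sum, h.1, h.2.1, h.2.2.1, h.2.2.2]
  simp [mul_assoc, ← Finset.mul_sum, Finset.sum_mul, Matrix.trace, Matrix.mul_apply]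

theorem permTrace_typeRep_seven (A : Fin 4 → Matrix ι ι ℂ) :
    permTrace (typeRep 7) A = (A 0 * A 1 * A 2 * A 3).trace := by
  have h : typeRep 7 0 = 1 ∧ typeRep 7 1 = 2 ∧ typeRep 7 2 = 3 ∧ typeRep 7 3 = 0 := by decide
  rw [permTrace_eq_sum, h.1, h.2.1, h.2.2.1, h.2.2.2]
  simp only [Matrix.trace, Matrix.mul_apply, Matrix.diag, Finset.sum_mul]
  refine Finset.sum_congr rfl fun a _ => ?_
  conv_rhs => enter [2, e]; rw [Finset.sum_comm]
  conv_rhs => rw [Finset.sum_comm]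
  refine Finset.sum_congr rfl fun b _ => ?_
  rw [Finset.sum_comm]
  rfl

/-- Types two, five and six come from types one, four and seven by exchanging the tensor factors 1
and 2. -/
theorem permTrace_typeRep_two (A : Fin 4 → Matrix ι ι ℂ) :
    permTrace (typeRep 2) A = (A 0 * A 2).trace * (A 1).trace * (A 3).trace := by
  have h : typeRep 2 = swap 1 2 * typeRep 1 * (swap 1 2)⁻¹ := by decide
  rw [h, permTrace_conj, permTrace_typeRep_one]
  rfl

theorem permTrace_typeRep_five (A : Fin 4 → Matrix ι ι ℂ) :
    permTrace (typeRep 5) A = (A 0 * A 2).trace * (A 1 * A 3).trace := by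
  have h : typeRep 5 = swap 1 2 * typeRep 4 * (swap 1 2)⁻¹ := by decide
  rw [h, permTrace_conj, permTrace_typeRep_four]
  rfl

theorem permTrace_typeRep_six (A : Fin 4 → Matrix ι ι ℂ) :
    permTrace (typeRep 6) A = (A 0 * A 2 * A 1 * A 3).trace := by
  have h : typeRep 6 = swap 1 2 * typeRep 7 * (swap 1 2)⁻¹ := by decide
  rw [h, permTrace_conj, permTrace_typeRep_seven]
  rfl

theorem permTrace_one (σ : Perm (Fin 4)) :
    permTrace σ (fun _ => (1 : Matrix ι ι ℂ))
      = (Fintype.card ι : ℂ) ^ ((cycleCount (permType σ) : ℕ) + 1) := by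
  obtain ⟨τ, hτ, -⟩ := exists_conj_typeRep σ
  rw [hτ, permTrace_conj, ← hτ]
  generalize permType σ = s
  fin_cases s <;>
  simp [permTrace_typeRep_zero, permTrace_typeRep_one, permTrace_typeRep_two,
    permTrace_typeRep_three, permTrace_typeRep_four, permTrace_typeRep_five,
    permTrace_typeRep_six, permTrace_typeRep_seven, cycleCount] <;> ring

/-- The values of `permTrace` on two copies of a traceless unitary matrix and two copies of its
inverse. -/
def pairTrace (d S : ℂ) : Fin 8 → ℂ := ![0, 0, 0, 0, S, d ^ 2, d, d]

theorem permTrace_typeRep_pair {B B' : Matrix ι ι ℂ} (h : B * B' = 1) (hB : B.trace = 0)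
    (hB' : B'.trace = 0) (s : Fin 8) : permTrace (typeRep s) ![B, B, B', B']
      = pairTrace (Fintype.card ι) ((B * B).trace * (B' * B').trace) s := by
  have h' : B' * B = 1 := mul_eq_one_comm.mp h
  have h1 : B * B * B' * B' = 1 := by rw [mul_assoc B, h, mul_one, h]
  fin_cases s <;>
  simp [permTrace_typeRep_zero, permTrace_typeRep_one, permTrace_typeRep_two,
    permTrace_typeRep_three, permTrace_typeRep_four, permTrace_typeRep_five,
    permTrace_typeRep_six, permTrace_typeRep_seven, pairTrace, hB, hB', h, h1, sq]

theorem permTrace_pair {B B' : Matrix ι ι ℂ} (h : B * B' = 1) (hB : B.trace = 0)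
    (hB' : B'.trace = 0) (σ : Perm (Fin 4)) : permTrace σ ![B, B, B', B']
      = pairTrace (Fintype.card ι) ((B * B).trace * (B' * B').trace) (permType σ) := by
  obtain ⟨τ, hτ, hτ'⟩ := exists_conj_typeRep σ
  rw [hτ, permTrace_conj, ← hτ]
  have hlo : ∀ k : Fin 4, k < 2 → (![B, B, B', B'] : Fin 4 → Matrix ι ι ℂ) k = B := by
    intro k hk; fin_cases k <;> first | rfl | exact absurd hk (by decide)
  have hhi : ∀ k : Fin 4, 2 ≤ k → (![B, B, B', B'] : Fin 4 → Matrix ι ι ℂ) k = B' := by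
    intro k hk; fin_cases k <;> first | rfl | exact absurd hk (by decide)
  rcases hτ' with ⟨h0, h1, h2, h3⟩ | ⟨h0, h1, h2, h3⟩
  · have : (![B, B, B', B'] : Fin 4 → Matrix ι ι ℂ) ∘ τ = ![B, B, B', B'] := by
      ext1 k; fin_cases k
      exacts [hlo _ h0, hlo _ h1, hhi _ h2, hhi _ h3]
    rw [this, permTrace_typeRep_pair h hB hB']
  -- Here `τ` exchanges the pairs, which is harmless because `pairTrace` is symmetric in `B` and
  -- `B'`.
  · have : (![B, B, B', B'] : Fin 4 → Matrix ι ι ℂ) ∘ τ = ![B', B', B, B] := by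
      ext1 k; fin_cases k
      exacts [hhi _ h0, hhi _ h1, hlo _ h2, hlo _ h3]
    rw [this, permTrace_typeRep_pair (mul_eq_one_comm.mp h) hB' hB, mul_comm (B' * B').trace]

/-- The Weingarten coefficients for a matrix whose square is traceless. -/
def coeffGeneric (d : ℂ) : Fin 8 → ℂ := fun s =>
  ![2, 0, -d, 1, -2, d ^ 2 - 2, -d, 0] s / ((d ^ 2 - 1) * (d ^ 2 - 4))

/-- The Weingarten coefficients for a matrix whose square is a scalar. -/
def coeffInvolutive (d : ℂ) : Fin 8 → ℂ := fun s =>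
  ![3, -d, -d, 3, d ^ 2 - 6, d ^ 2 - 6, -d, -d] s / ((d ^ 2 - 1) * (d ^ 2 - 9))

/-- The system is linear in `S = |tr B²|²`, and only `S = 0` and `S = d²` occur. Treating them
separately keeps the pole at `d = 3` out of this solution and the pole at `d = 2` out of
`coeffInvolutive`, as each case needs. -/
theorem sum_coeffGeneric {d : ℂ} (h1 : d ^ 2 - 1 ≠ 0) (h4 : d ^ 2 - 4 ≠ 0) (s : Fin 8) :
    ∑ i, ∑ j : Fin 4, typeCount s i j * (coeffGeneric d i * d ^ ((j : ℕ) + 1))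
      = pairTrace d 0 s := by
  fin_cases s <;>
  · simp [Fin.sum_univ_eight, Fin.sum_univ_four, typeCount, coeffGeneric, pairTrace]
    field_simp
    ring

theorem sum_coeffInvolutive {d : ℂ} (h1 : d ^ 2 - 1 ≠ 0) (h9 : d ^ 2 - 9 ≠ 0) (s : Fin 8) :
    ∑ i, ∑ j : Fin 4, typeCount s i j * (coeffInvolutive d i * d ^ ((j : ℕ) + 1))
      = pairTrace d (d ^ 2) s := by
  fin_cases s <;>
  · simp [Fin.sum_univ_eight, Fin.sum_univ_four, typeCount, coeffInvolutive, pairTrace]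
    field_simp
    ring

end FourFold

/-! ### Fourth moments for traceless unitary matrices. -/

section FourthMoment

variable {ι : Type*} [Fintype ι] [DecidableEq ι]

/-- The number of permutations of each type. -/
def typeCard : Fin 8 → ℕ := ![1, 2, 4, 8, 1, 2, 2, 4]

set_option maxRecDepth 100000 in
theorem card_permType : ∀ i : Fin 8,
    (Finset.univ.filter fun π : Perm (Fin 4) => permType π = i).card = typeCard i := by
  decide +kernel

theorem sum_permType (F : Fin 8 → ℂ) : ∑ π, F (permType π) = ∑ i, typeCard i * F i := by
  rw [← Finset.sum_fiberwise (Finset.univ : Finset (Perm (Fin 4))) permType]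
  refine Finset.sum_congr rfl fun i _ => ?_
  rw [← card_permType, ← nsmul_eq_mul, ← Finset.sum_const]
  exact Finset.sum_congr rfl fun π hπ => by rw [(Finset.mem_filter.mp hπ).2]

/-- The fourth moment of `|tr (A† U B U†)|`. -/
def fourthMoment (A B : Matrix ι ι ℂ) : ℝ :=
  ∫ U : Matrix.unitaryGroup ι ℂ, ‖(A.conjTranspose * (U : Matrix ι ι ℂ) * B *
    (U : Matrix ι ι ℂ).conjTranspose).trace‖ ^ 4 ∂haarProb ι

/-- `|z|⁴ = z² z̄²`, and conjugating `z = tr (A† U B U†)` replaces `A†` by `A` and `B` by `B†`. -/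
theorem ofReal_fourthMoment (A B : Matrix ι ι ℂ) :
    (fourthMoment A B : ℂ) = ∫ U : Matrix.unitaryGroup ι ℂ,
      ∏ k : Fin 4, ((![A.conjTranspose, A.conjTranspose, A, A] : Fin 4 → Matrix ι ι ℂ) k *
        ((U : Matrix ι ι ℂ) * (![B, B, B.conjTranspose, B.conjTranspose] :
          Fin 4 → Matrix ι ι ℂ) k * (U : Matrix ι ι ℂ).conjTranspose)).trace ∂haarProb ι := by
  rw [fourthMoment, ← integral_complex_ofReal]
  congr 1
  ext1 U
  simp only [Fin.prod_univ_four, Matrix.cons_val]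
  have h : (A * ((U : Matrix ι ι ℂ) * B.conjTranspose * (U : Matrix ι ι ℂ).conjTranspose)).trace
      = star (A.conjTranspose * ((U : Matrix ι ι ℂ) * B *
        (U : Matrix ι ι ℂ).conjTranspose)).trace := by
    rw [← Matrix.trace_conjTranspose, Matrix.trace_mul_comm]
    simp [Matrix.conjTranspose_mul, mul_assoc]
  rw [h, mul_assoc A.conjTranspose, mul_assoc A.conjTranspose]
  generalize (A.conjTranspose * ((U : Matrix ι ι ℂ) * B *
        (U : Matrix ι ι ℂ).conjTranspose)).trace = z
  have hz : z * star z = ((‖z‖ ^ 2 : ℝ) : ℂ) := by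
    simpa using Complex.mul_conj' z
  calc ((‖z‖ ^ 4 : ℝ) : ℂ) = ((‖z‖ ^ 2 : ℝ) : ℂ) * ((‖z‖ ^ 2 : ℝ) : ℂ) := by push_cast; ring
    _ = z * z * star z * star z := by rw [← hz]; ring

theorem mul_conj_trace_sq (A : Matrix ι ι ℂ) :
    (A * A).trace * (A.conjTranspose * A.conjTranspose).trace = ((‖(A * A).trace‖ ^ 2 : ℝ) : ℂ) := by
  rw [← Matrix.conjTranspose_mul, Matrix.trace_conjTranspose]
  simpa using Complex.mul_conj' (A * A).trace

/-- The hypothesis `hg` is the Gram system reduced to types. Both the coefficients and the traces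
against `A` are constant on types, so the final sum is weighted by `typeCard`. -/
theorem ofReal_fourthMoment_eq {A B : Matrix ι ι ℂ} (hA : A * A.conjTranspose = 1)
    (hA0 : A.trace = 0) (hB : B * B.conjTranspose = 1) (hB0 : B.trace = 0) {g : Fin 8 → ℂ}
    (hg : ∀ s, ∑ i, ∑ j : Fin 4, typeCount s i j * (g i * (Fintype.card ι : ℂ) ^ ((j : ℕ) + 1))
      = pairTrace (Fintype.card ι) ((‖(B * B).trace‖ ^ 2 : ℝ) : ℂ) s) :
    (fourthMoment A B : ℂ) = ∑ i, typeCard i * (g i *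
      pairTrace (Fintype.card ι) ((‖(A * A).trace‖ ^ 2 : ℝ) : ℂ) i) := by
  have hA0' : A.conjTranspose.trace = 0 := by rw [Matrix.trace_conjTranspose, hA0, star_zero]
  have hB0' : B.conjTranspose.trace = 0 := by rw [Matrix.trace_conjTranspose, hB0, star_zero]
  rw [ofReal_fourthMoment, integral_prod_trace (c := fun π => g (permType π)),
    ← sum_permType fun i => g i * pairTrace (Fintype.card ι) ((‖(A * A).trace‖ ^ 2 : ℝ) : ℂ) i]
  · refine Finset.sum_congr rfl fun π _ => ?_
    rw [permTrace_pair (mul_eq_one_comm.mp hA) hA0' hA0, mul_comm (Matrix.trace _),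
      mul_conj_trace_sq]
  · intro σ
    rw [permTrace_pair hB hB0 hB0', mul_conj_trace_sq, ← hg]
    simp only [permTrace_one]
    exact sum_permType_eq g (fun j => (Fintype.card ι : ℂ) ^ ((j : ℕ) + 1)) σ

theorem fourthMoment_eq_of_trace_sq_eq_zero {A B : Matrix ι ι ℂ} {d : ℝ}
    (hd : d = Fintype.card ι) (h1 : d ^ 2 - 1 ≠ 0) (h4 : d ^ 2 - 4 ≠ 0)
    (hA : A * A.conjTranspose = 1) (hA0 : A.trace = 0) (hB : B * B.conjTranspose = 1)
    (hB0 : B.trace = 0) (hB2 : ‖(B * B).trace‖ ^ 2 = 0) :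
    fourthMoment A B = (2 * d ^ 4 - 6 * d ^ 2 - 2 * ‖(A * A).trace‖ ^ 2)
      / ((d ^ 2 - 1) * (d ^ 2 - 4)) := by
  have hd' : (Fintype.card ι : ℂ) = (d : ℂ) := by rw [hd]; simp
  have h1' : (d : ℂ) ^ 2 - 1 ≠ 0 := by exact_mod_cast h1
  have h4' : (d : ℂ) ^ 2 - 4 ≠ 0 := by exact_mod_cast h4
  have h := ofReal_fourthMoment_eq hA hA0 hB hB0 (g := coeffGeneric d) (by
    rw [hd', hB2]; simpa using sum_coeffGeneric h1' h4')
  rw [hd'] at h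
  apply Complex.ofReal_injective
  rw [h]
  generalize ‖(A * A).trace‖ ^ 2 = S
  simp [Fin.sum_univ_eight, typeCard, coeffGeneric, pairTrace]
  field_simp
  ring

theorem fourthMoment_eq_of_trace_sq_eq_sq {A B : Matrix ι ι ℂ} {d : ℝ}
    (hd : d = Fintype.card ι) (h1 : d ^ 2 - 1 ≠ 0) (h9 : d ^ 2 - 9 ≠ 0)
    (hA : A * A.conjTranspose = 1) (hA0 : A.trace = 0) (hB : B * B.conjTranspose = 1)
    (hB0 : B.trace = 0) (hB2 : ‖(B * B).trace‖ ^ 2 = d ^ 2) :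
    fourthMoment A B = (2 * d ^ 4 - 18 * d ^ 2 + (d ^ 2 - 6) * ‖(A * A).trace‖ ^ 2)
      / ((d ^ 2 - 1) * (d ^ 2 - 9)) := by
  have hd' : (Fintype.card ι : ℂ) = (d : ℂ) := by rw [hd]; simp
  have h1' : (d : ℂ) ^ 2 - 1 ≠ 0 := by exact_mod_cast h1
  have h9' : (d : ℂ) ^ 2 - 9 ≠ 0 := by exact_mod_cast h9
  have h := ofReal_fourthMoment_eq hA hA0 hB hB0 (g := coeffInvolutive d) (by
    rw [hd', hB2]; simpa using sum_coeffInvolutive h1' h9')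
  rw [hd'] at h
  apply Complex.ofReal_injective
  rw [h]
  generalize ‖(A * A).trace‖ ^ 2 = S
  simp [Fin.sum_univ_eight, typeCard, coeffInvolutive, pairTrace]
  field_simp
  ring

theorem fourthMoment_one_one :
    fourthMoment (1 : Matrix ι ι ℂ) 1 = (Fintype.card ι : ℝ) ^ 4 := by
  have h : ∀ U : Matrix.unitaryGroup ι ℂ,
      (U : Matrix ι ι ℂ) * (U : Matrix ι ι ℂ).conjTranspose = 1 := fun U =>
    Matrix.mem_unitaryGroup_iff.mp U.2
  simp [fourthMoment, h, Matrix.trace_one]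

theorem fourthMoment_one_right {A : Matrix ι ι ℂ} (hA : A.trace = 0) :
    fourthMoment A 1 = 0 := by
  have h : ∀ U : Matrix.unitaryGroup ι ℂ,
      (U : Matrix ι ι ℂ) * (U : Matrix ι ι ℂ).conjTranspose = 1 := fun U =>
    Matrix.mem_unitaryGroup_iff.mp U.2
  simp [fourthMoment, mul_assoc, h, Matrix.trace_conjTranspose, hA]

theorem fourthMoment_one_left {B : Matrix ι ι ℂ} (hB : B.trace = 0) :
    fourthMoment 1 B = 0 := by
  have h : ∀ U : Matrix.unitaryGroup ι ℂ,
      (U : Matrix ι ι ℂ).conjTranspose * (U : Matrix ι ι ℂ) = 1 := fun U =>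
    Matrix.mem_unitaryGroup_iff'.mp U.2
  have h' : ∀ U : Matrix.unitaryGroup ι ℂ,
      ((U : Matrix ι ι ℂ) * B * (U : Matrix ι ι ℂ).conjTranspose).trace = 0 := fun U => by
    rw [Matrix.trace_mul_comm, ← mul_assoc, h, one_mul, hB]
  simp [fourthMoment, h']

end FourthMoment

/-! ### Unitarity and traces of displacement operators. -/

section Displacement

variable (q : ℕ) [NeZero q]

theorem omega_pow_mul (k j : ZMod q) :
    omega q ^ (j.val * k.val) = ZMod.stdAddChar (k * j) := by
  have h : k * j = (((j.val * k.val : ℕ) : ℤ) : ZMod q) := by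
    push_cast
    rw [ZMod.natCast_zmod_val, ZMod.natCast_zmod_val, mul_comm]
  rw [h, ZMod.stdAddChar_coe, omega, ← Complex.exp_nat_mul]
  congr 1
  push_cast
  ring

theorem shift_pow_apply (m : ℕ) (j k : ZMod q) :
    (shift q ^ m) j k = if j = k + m then 1 else 0 := by
  induction m generalizing j k with
  | zero => simp [Matrix.one_apply]
  | succ m ih =>
    rw [pow_succ, Matrix.mul_apply, Finset.sum_eq_single (k + 1)]
    · have : k + 1 + (m : ZMod q) = k + (m + 1) := by ring
      rw [ih]; simp [shift, this]
    · intro l _ hl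
      simp [shift, hl]
    · simp

theorem displacement_apply (a : ZMod q × ZMod q) (j k : ZMod q) :
    displacement q a j k = tau q ^ (a.1.val * a.2.val) *
      if j = k + a.1 then ZMod.stdAddChar (a.2 * k) else 0 := by
  rw [displacement, clock, Matrix.diagonal_pow, Matrix.smul_apply, Matrix.mul_diagonal,
    shift_pow_apply, smul_eq_mul]
  congr 1
  simp [← omega_pow_mul, pow_mul]

theorem norm_tau_pow (m : ℕ) : ‖tau q ^ m‖ = 1 := by
  have h : Real.pi * Complex.I / q = ((Real.pi / q : ℝ) : ℂ) * Complex.I := by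
    push_cast; ring
  rw [norm_pow, tau, norm_neg, h, Complex.norm_exp_ofReal_mul_I, one_pow]

theorem norm_stdAddChar (j : ZMod q) : ‖ZMod.stdAddChar j‖ = 1 := by
  rw [ZMod.stdAddChar_apply]; exact Circle.norm_coe _

theorem displacement_zero : displacement q 0 = 1 := by
  simp [displacement]

theorem displacement_mul_conjTranspose (a : ZMod q × ZMod q) :
    displacement q a * (displacement q a).conjTranspose = 1 := by
  rw [mul_eq_one_comm]
  ext k l
  rw [Matrix.mul_apply, Finset.sum_eq_single (l + a.1)]
  · simp only [Matrix.conjTranspose_apply, displacement_apply, Matrix.one_apply]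
    by_cases h : k = l
    · subst h
      simp only [if_true]
      have : ∀ z w : ℂ, star (z * w) * (z * w) = ((‖z‖ ^ 2 * ‖w‖ ^ 2 : ℝ) : ℂ) := by
        intro z w
        have := Complex.conj_mul' (z * w)
        rw [norm_mul, ← Complex.ofReal_pow, mul_pow] at this
        exact this
      rw [this, norm_tau_pow, norm_stdAddChar]
      simp
    · have h' : ¬ l = k := fun e => h e.symm
      simp [h, h']
  · intro j _ hj
    simp [displacement_apply, hj]
  · simp

theorem sum_stdAddChar_mul (b : ZMod q) :
    ∑ j : ZMod q, ZMod.stdAddChar (b * j) = if b = 0 then (q : ℂ) else 0 := by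
  have := AddChar.sum_mulShift b (ZMod.isPrimitive_stdAddChar q)
  simp only [ZMod.card] at this
  simp only [mul_comm b, this]
  split_ifs <;> simp

theorem trace_displacement {a : ZMod q × ZMod q} (ha : a ≠ 0) : (displacement q a).trace = 0 := by
  simp only [Matrix.trace, Matrix.diag, displacement_apply, ← Finset.mul_sum]
  by_cases h1 : a.1 = 0
  · have h2 : a.2 ≠ 0 := fun h => ha (Prod.ext h1 h)
    simp [h1, sum_stdAddChar_mul, h2]
  · simp [h1]

/-- Up to a phase `D_a²` is `X^(2a₁) Z^(2a₂)`: its diagonal vanishes unless `2a₁ = 0`, and then its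
trace is a character sum that vanishes unless `2a₂ = 0`. -/
theorem norm_trace_displacement_sq (a : ZMod q × ZMod q) :
    ‖(displacement q a * displacement q a).trace‖ ^ 2 = if a + a = 0 then (q : ℝ) ^ 2 else 0 := by
  have h : (displacement q a * displacement q a).trace
      = tau q ^ (a.1.val * a.2.val) * tau q ^ (a.1.val * a.2.val) *
        if a.1 + a.1 = 0 then ZMod.stdAddChar (a.2 * a.1) *
          ∑ j : ZMod q, ZMod.stdAddChar ((a.2 + a.2) * j) else 0 := by
    simp only [Matrix.trace, Matrix.diag, Matrix.mul_apply]
    rw [Finset.sum_comm]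
    have : ∀ k : ZMod q, ∑ j, displacement q a j k * displacement q a k j
        = tau q ^ (a.1.val * a.2.val) * tau q ^ (a.1.val * a.2.val) *
          if a.1 + a.1 = 0 then ZMod.stdAddChar (a.2 * a.1) *
            ZMod.stdAddChar ((a.2 + a.2) * k) else 0 := by
      intro k
      rw [Finset.sum_eq_single (k + a.1)]
      · simp only [displacement_apply, if_true, add_assoc, left_eq_add]
        split_ifs
        · have : (a.2 + a.2) * k = a.2 * k + a.2 * k := by ring
          rw [this, mul_add a.2, AddChar.map_add_eq_mul, AddChar.map_add_eq_mul]
          ring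
        · simp
      · intro j _ hj
        simp [displacement_apply, hj]
      · simp
    simp only [this, ← Finset.mul_sum]
    split_ifs <;> simp [Finset.mul_sum]
  rw [h, sum_stdAddChar_mul]
  simp only [Prod.ext_iff, Prod.fst_add, Prod.snd_add, Prod.fst_zero, Prod.snd_zero]
  rw [norm_mul, norm_mul, norm_tau_pow]
  by_cases h1 : a.1 + a.1 = 0 <;> by_cases h2 : a.2 + a.2 = 0 <;> simp [h1, h2]

variable (n : ℕ)

theorem multiDisplacement_eq (a : Fin n → ZMod q × ZMod q) :
    multiDisplacement q n a = tens fun i => displacement q (a i) := rfl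

theorem multiDisplacement_zero : multiDisplacement q n 0 = 1 := by
  rw [multiDisplacement_eq, ← tens_one]
  simp [displacement_zero]

theorem multiDisplacement_mul_conjTranspose (a : Fin n → ZMod q × ZMod q) :
    multiDisplacement q n a * (multiDisplacement q n a).conjTranspose = 1 := by
  simp only [multiDisplacement_eq, tens_conjTranspose, tens_mul, displacement_mul_conjTranspose,
    tens_one]

theorem trace_multiDisplacement {a : Fin n → ZMod q × ZMod q} (ha : a ≠ 0) :
    (multiDisplacement q n a).trace = 0 := by
  obtain ⟨i, hi⟩ := Function.ne_iff.mp ha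
  rw [multiDisplacement_eq, trace_tens]
  exact Finset.prod_eq_zero (Finset.mem_univ i) (trace_displacement q hi)

theorem norm_trace_multiDisplacement_sq (a : Fin n → ZMod q × ZMod q) :
    ‖(multiDisplacement q n a * multiDisplacement q n a).trace‖ ^ 2
      = if a + a = 0 then ((q : ℝ) ^ n) ^ 2 else 0 := by
  rw [multiDisplacement_eq, tens_mul, trace_tens, norm_prod, ← Finset.prod_pow]
  simp only [norm_trace_displacement_sq, Finset.prod_ite_zero, Finset.mem_univ, true_imp_iff,
    funext_iff, Pi.add_apply, Pi.zero_apply]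
  simp [← pow_mul, mul_comm]

end Displacement

/-! ### Summing over labels, and counting labels of order two. -/

section Average

variable (q : ℕ) [NeZero q] (n : ℕ)

theorem haarAverage_eq_sum : haarAverage q n
    = 1 - (∑ a, ∑ b, fourthMoment (multiDisplacement q n a) (multiDisplacement q n b))
      / ((q : ℝ) ^ n) ^ 6 := by
  have hent : ∀ U : Matrix.unitaryGroup (Label q n) ℂ, entropy q n 2 U
      = 1 - (∑ a, ∑ b, ‖((multiDisplacement q n a).conjTranspose *
        (U : Matrix (Label q n) (Label q n) ℂ) * multiDisplacement q n b *
        (U : Matrix (Label q n) (Label q n) ℂ).conjTranspose).trace‖ ^ 4)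
        / ((q : ℝ) ^ n) ^ 6 := by
    intro U
    have hq : (q : ℝ) ≠ 0 := NeZero.ne _
    simp only [entropy, charFun, Real.rpow_ofNat, ← pow_mul, norm_mul, mul_pow,
      ← Finset.mul_sum]
    push_cast
    simp
    field_simp
    norm_num
    rw [pow_mul]
    ring
  have hint : ∀ a b, Integrable (fun U : Matrix.unitaryGroup (Label q n) ℂ =>
      ‖((multiDisplacement q n a).conjTranspose *
        (U : Matrix (Label q n) (Label q n) ℂ) * multiDisplacement q n b *
        (U : Matrix (Label q n) (Label q n) ℂ).conjTranspose).trace‖ ^ 4)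
      (haarProb (Label q n)) := by
    intro a b
    refine Continuous.integrable_of_hasCompactSupport ?_ (HasCompactSupport.of_compactSpace _)
    refine (Continuous.norm (Continuous.matrix_trace ?_)).pow 4
    exact ((continuous_const.mul continuous_subtype_val).mul continuous_const).mul
      (Continuous.matrix_conjTranspose continuous_subtype_val)
  simp only [haarAverage, hent]
  rw [integral_sub (integrable_const _) ((integrable_finsetSum _ fun a _ =>
    integrable_finsetSum _ fun b _ => hint a b).div_const _), integral_div,
    integral_finsetSum _ fun a _ => integrable_finsetSum _ fun b _ => hint a b]
  simp only [integral_finsetSum _ fun b _ => hint _ b, integral_const, probReal_univ, one_smul]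
  rfl

/-- The set of nonzero labels of order two. -/
def orderTwo : Finset (Fin n → ZMod q × ZMod q) :=
  Finset.univ.filter fun a => a ≠ 0 ∧ a + a = 0

/-- The set of labels of order larger than two. -/
def orderLarge : Finset (Fin n → ZMod q × ZMod q) :=
  Finset.univ.filter fun a => a + a ≠ 0

theorem card_orderLarge :
    ((orderLarge q n).card : ℝ) = ((q : ℝ) ^ n) ^ 2 - 1 - (orderTwo q n).card := by
  have h1 := Finset.card_filter_add_card_filter_not
    (s := (Finset.univ : Finset (Fin n → ZMod q × ZMod q))) (fun a => a + a = 0)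
  have h2 : Finset.univ.filter (fun a : Fin n → ZMod q × ZMod q => a + a = 0)
      = insert 0 (orderTwo q n) := by
    ext a
    by_cases h : a = 0 <;> simp [orderTwo, h]
  rw [h2, Finset.card_insert_of_notMem (by simp [orderTwo])] at h1
  have h3 : (Finset.univ : Finset (Fin n → ZMod q × ZMod q)).card = (q ^ n) ^ 2 := by
    simp [ZMod.card, ← pow_mul]
    ring
  rw [h3] at h1
  have h4 : ((((orderTwo q n).card + 1 + (orderLarge q n).card : ℕ)) : ℝ)
      = (((q ^ n) ^ 2 : ℕ) : ℝ) := congrArg _ h1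
  push_cast at h4
  linarith

variable {q n}

theorem two_le_pow_of_ne_zero {a : Fin n → ZMod q × ZMod q} (ha : a ≠ 0) : 2 ≤ q ^ n := by
  obtain ⟨i, hi⟩ := Function.ne_iff.mp ha
  have hn : n ≠ 0 := by rintro rfl; exact i.elim0
  have hq : q ≠ 1 := by
    rintro rfl
    exact hi (Subsingleton.elim _ _)
  have hq0 : q ≠ 0 := NeZero.ne q
  calc 2 ≤ q := by omega
    _ ≤ q ^ n := Nat.le_self_pow hn q

/-- Keeps `d² - 4` from vanishing wherever `coeffGeneric` is applied. -/
theorem three_le_pow_of_add_self_ne_zero {a : Fin n → ZMod q × ZMod q} (ha : a + a ≠ 0) :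
    3 ≤ q ^ n := by
  obtain ⟨i, hi⟩ := Function.ne_iff.mp ha
  have hn : n ≠ 0 := by rintro rfl; exact i.elim0
  have hq : q ≠ 1 := by
    rintro rfl
    exact hi (Subsingleton.elim _ _)
  have hq2 : q ≠ 2 := by
    rintro rfl
    exact hi (Prod.ext (CharTwo.add_self_eq_zero _) (CharTwo.add_self_eq_zero _))
  have hq0 : q ≠ 0 := NeZero.ne q
  calc 3 ≤ q := by omega
    _ ≤ q ^ n := Nat.le_self_pow hn q

theorem zmod_eq_zero_of_add_self_of_odd (hq : Odd q) {x : ZMod q} (hx : x + x = 0) : x = 0 := by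
  have h2 : IsUnit ((2 : ℕ) : ZMod q) :=
    (ZMod.isUnit_iff_coprime 2 q).mpr (Nat.coprime_two_left.mpr hq)
  rw [← two_mul] at hx
  exact (IsUnit.mul_right_eq_zero (by exact_mod_cast h2)).mp hx

theorem eq_zero_of_add_self_of_odd (hq : Odd q) {a : Fin n → ZMod q × ZMod q} (ha : a + a = 0) :
    a = 0 := by
  ext1 i
  have h := congrFun ha i
  exact Prod.ext (zmod_eq_zero_of_add_self_of_odd hq (congrArg Prod.fst h))
    (zmod_eq_zero_of_add_self_of_odd hq (congrArg Prod.snd h))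

/-- Keeps `d² - 9` from vanishing wherever `coeffInvolutive` is applied. -/
theorem pow_ne_three_of_mem_orderTwo {a : Fin n → ZMod q × ZMod q} (ha : a ∈ orderTwo q n) :
    q ^ n ≠ 3 := by
  simp only [orderTwo, Finset.mem_filter, Finset.mem_univ, true_and] at ha
  intro h
  have hn : n ≠ 0 := by rintro rfl; simp at h
  have ho : Odd (q ^ n) := by rw [h]; decide
  exact ha.1 (eq_zero_of_add_self_of_odd ((Nat.odd_pow_iff hn).mp ho) ha.2)

theorem fourthMoment_multiDisplacement_of_mem_orderLarge {d : ℝ} (hd : d = (q : ℝ) ^ n)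
    {a b : Fin n → ZMod q × ZMod q} (ha : a ≠ 0) (hb : b ∈ orderLarge q n) :
    fourthMoment (multiDisplacement q n a) (multiDisplacement q n b)
      = if a + a = 0 then 2 * d ^ 2 / (d ^ 2 - 1)
        else 2 * d ^ 2 * (d ^ 2 - 3) / ((d ^ 2 - 1) * (d ^ 2 - 4)) := by
  simp only [orderLarge, Finset.mem_filter, Finset.mem_univ, true_and] at hb
  have hb0 : b ≠ 0 := by rintro rfl; simp at hb
  have h3 : (3 : ℝ) ≤ d := by
    rw [hd]; exact_mod_cast three_le_pow_of_add_self_ne_zero hb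
  have h1 : d ^ 2 - 1 ≠ 0 := by nlinarith
  have h4 : d ^ 2 - 4 ≠ 0 := by nlinarith
  rw [fourthMoment_eq_of_trace_sq_eq_zero (d := d) (by simp [hd, ZMod.card]) h1 h4
    (multiDisplacement_mul_conjTranspose q n a) (trace_multiDisplacement q n ha)
    (multiDisplacement_mul_conjTranspose q n b) (trace_multiDisplacement q n hb0)
    (by rw [norm_trace_multiDisplacement_sq, if_neg hb]), norm_trace_multiDisplacement_sq, ← hd]
  split_ifs
  · field_simp; ring
  · field_simp; ring

theorem fourthMoment_multiDisplacement_of_mem_orderTwo {d : ℝ} (hd : d = (q : ℝ) ^ n)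
    {a b : Fin n → ZMod q × ZMod q} (ha : a ≠ 0) (hb : b ∈ orderTwo q n) :
    fourthMoment (multiDisplacement q n a) (multiDisplacement q n b)
      = if a + a = 0 then 3 * d ^ 2 * (d ^ 2 - 8) / ((d ^ 2 - 1) * (d ^ 2 - 9))
        else 2 * d ^ 2 / (d ^ 2 - 1) := by
  have h3 : q ^ n ≠ 3 := pow_ne_three_of_mem_orderTwo hb
  simp only [orderTwo, Finset.mem_filter, Finset.mem_univ, true_and] at hb
  have h2 : 2 ≤ q ^ n := two_le_pow_of_ne_zero ha
  have h2' : (2 : ℝ) ≤ d := by rw [hd]; exact_mod_cast h2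
  have h3' : d ≠ 3 := by rw [hd]; exact_mod_cast h3
  have h1 : d ^ 2 - 1 ≠ 0 := by nlinarith
  have h9 : d ^ 2 - 9 ≠ 0 := by
    have : d ^ 2 - 9 = (d - 3) * (d + 3) := by ring
    rw [this]
    exact mul_ne_zero (sub_ne_zero.mpr h3') (by linarith)
  rw [fourthMoment_eq_of_trace_sq_eq_sq (d := d) (by simp [hd, ZMod.card]) h1 h9
    (multiDisplacement_mul_conjTranspose q n a) (trace_multiDisplacement q n ha)
    (multiDisplacement_mul_conjTranspose q n b) (trace_multiDisplacement q n hb.1)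
    (by rw [norm_trace_multiDisplacement_sq, if_pos hb.2, hd]),
    norm_trace_multiDisplacement_sq, ← hd]
  split_ifs
  · field_simp; ring
  · field_simp; ring

theorem sum_eq_zero_add_orderTwo_add_orderLarge (F : (Fin n → ZMod q × ZMod q) → ℝ) :
    ∑ a, F a = F 0 + ∑ a ∈ orderTwo q n, F a + ∑ a ∈ orderLarge q n, F a := by
  rw [← Finset.sum_filter_add_sum_filter_not Finset.univ (fun a => a + a = 0)]
  have h2 : Finset.univ.filter (fun a : Fin n → ZMod q × ZMod q => a + a = 0)
      = insert 0 (orderTwo q n) := by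
    ext a
    by_cases h : a = 0 <;> simp [orderTwo, h]
  rw [h2, Finset.sum_insert (by simp [orderTwo])]
  rfl

/-- The pair `(0, 0)` contributes `d⁴`, pairs with exactly one zero label contribute nothing, and
the rest is split by whether `2a` and `2b` vanish. A fraction with zero denominator is harmless
here, since its weight `t` or `l` is then zero. -/
theorem haarAverage_eq {d : ℝ} (hd : d = (q : ℝ) ^ n) {t l : ℝ} (ht : t = (orderTwo q n).card)
    (hl : l = d ^ 2 - 1 - t) : haarAverage q n
      = 1 - (d ^ 4 + t * (t * (3 * d ^ 2 * (d ^ 2 - 8) / ((d ^ 2 - 1) * (d ^ 2 - 9)))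
        + l * (2 * d ^ 2 / (d ^ 2 - 1))) + l * (t * (2 * d ^ 2 / (d ^ 2 - 1))
        + l * (2 * d ^ 2 * (d ^ 2 - 3) / ((d ^ 2 - 1) * (d ^ 2 - 4))))) / d ^ 6 := by
  have hl' : l = (orderLarge q n).card := by rw [card_orderLarge, ← hd, ← ht, hl]
  have htwo : ∀ {a}, a ∈ orderTwo q n → a ≠ 0 ∧ a + a = 0 := fun h => by
    simpa [orderTwo] using h
  have hlarge : ∀ {a}, a ∈ orderLarge q n → a ≠ 0 ∧ a + a ≠ 0 := fun {a} h => by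
    have h' : a + a ≠ 0 := by simpa [orderLarge] using h
    exact ⟨by rintro rfl; simp at h', h'⟩
  have hz : ∀ a, a ≠ 0 → fourthMoment (multiDisplacement q n a) (multiDisplacement q n 0) = 0 :=
    fun a ha => by
      rw [multiDisplacement_zero]
      exact fourthMoment_one_right (trace_multiDisplacement q n ha)
  have hz' : ∀ b, b ≠ 0 → fourthMoment (multiDisplacement q n 0) (multiDisplacement q n b) = 0 :=
    fun b hb => by
      rw [multiDisplacement_zero]
      exact fourthMoment_one_left (trace_multiDisplacement q n hb)
  rw [haarAverage_eq_sum, ← hd]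
  congr 2
  rw [sum_eq_zero_add_orderTwo_add_orderLarge, sum_eq_zero_add_orderTwo_add_orderLarge,
    Finset.sum_eq_zero (fun b hb => hz' b (htwo hb).1),
    Finset.sum_eq_zero (fun b hb => hz' b (hlarge hb).1), add_zero, add_zero]
  congr 1
  · congr 1
    · rw [multiDisplacement_zero, fourthMoment_one_one, hd]
      simp [ZMod.card]
    · rw [ht, ← nsmul_eq_mul, ← Finset.sum_const]
      refine Finset.sum_congr rfl fun a ha => ?_
      rw [sum_eq_zero_add_orderTwo_add_orderLarge, hz a (htwo ha).1, zero_add]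
      congr 1
      · rw [← nsmul_eq_mul, ← Finset.sum_const]
        exact Finset.sum_congr rfl fun b hb => by
          rw [fourthMoment_multiDisplacement_of_mem_orderTwo hd (htwo ha).1 hb, if_pos (htwo ha).2]
      · rw [hl', ← nsmul_eq_mul, ← Finset.sum_const]
        exact Finset.sum_congr rfl fun b hb => by
          rw [fourthMoment_multiDisplacement_of_mem_orderLarge hd (htwo ha).1 hb,
            if_pos (htwo ha).2]
  · rw [hl', ← nsmul_eq_mul, ← Finset.sum_const]
    refine Finset.sum_congr rfl fun a ha => ?_
    rw [sum_eq_zero_add_orderTwo_add_orderLarge, hz a (hlarge ha).1, zero_add]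
    congr 1
    · rw [ht, ← nsmul_eq_mul, ← Finset.sum_const]
      exact Finset.sum_congr rfl fun b hb => by
        rw [fourthMoment_multiDisplacement_of_mem_orderTwo hd (hlarge ha).1 hb,
          if_neg (hlarge ha).2]
    · rw [← nsmul_eq_mul, ← Finset.sum_const]
      exact Finset.sum_congr rfl fun b hb => by
        rw [fourthMoment_multiDisplacement_of_mem_orderLarge hd (hlarge ha).1 hb,
          if_neg (hlarge ha).2]

theorem card_orderTwo_of_odd (hq : Odd q) : (orderTwo q n).card = 0 := by
  rw [Finset.card_eq_zero, Finset.eq_empty_iff_forall_notMem]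
  intro a ha
  simp only [orderTwo, Finset.mem_filter, Finset.mem_univ, true_and] at ha
  exact ha.1 (eq_zero_of_add_self_of_odd hq ha.2)

theorem card_orderTwo_two : ((orderTwo 2 n).card : ℝ) = ((2 : ℝ) ^ n) ^ 2 - 1 := by
  have h := card_orderLarge 2 n
  have h0 : (orderLarge 2 n).card = 0 := by
    rw [Finset.card_eq_zero, Finset.eq_empty_iff_forall_notMem]
    intro a ha
    simp only [orderLarge, Finset.mem_filter, Finset.mem_univ, true_and] at ha
    exact ha (funext fun i =>
      Prod.ext (CharTwo.add_self_eq_zero _) (CharTwo.add_self_eq_zero _))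
  rw [h0] at h
  push_cast at h
  linarith

/-- The solutions are `0` and `q / 2`; so the 2-torsion of `ZMod q × ZMod q` has four elements,
three of them nonzero. -/
theorem card_add_self_eq_zero_of_even (hq : Even q) :
    (Finset.univ.filter fun x : ZMod q => x + x = 0).card = 2 := by
  obtain ⟨m, rfl⟩ := hq
  have hm : m ≠ 0 := by rintro rfl; exact NeZero.ne (0 + 0) rfl
  have hne : ((m : ℕ) : ZMod (m + m)) ≠ 0 := by
    rw [Ne, ZMod.natCast_eq_zero_iff]
    exact fun h => by have := Nat.le_of_dvd (by omega) h; omega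
  rw [← Finset.card_pair hne.symm]
  congr 1
  ext x
  simp only [Finset.mem_filter, Finset.mem_univ, true_and, Finset.mem_insert,
    Finset.mem_singleton, add_eq_zero_iff_neg_eq, ZMod.neg_eq_self_iff]
  refine or_congr_right ⟨fun h => ?_, fun h => ?_⟩
  · rw [← ZMod.natCast_zmod_val x]
    congr 1
    omega
  · rw [h, ZMod.val_natCast, Nat.mod_eq_of_lt (by omega)]
    omega

theorem card_orderTwo_one_of_even (hq : Even q) : (orderTwo q 1).card = 3 := by
  have h2 : Finset.univ.filter (fun a : Fin 1 → ZMod q × ZMod q => a + a = 0)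
      = insert 0 (orderTwo q 1) := by
    ext a
    by_cases h : a = 0 <;> simp [orderTwo, h]
  have h3 : (Finset.univ.filter fun a : Fin 1 → ZMod q × ZMod q => a + a = 0).card
      = ((Finset.univ.filter fun x : ZMod q => x + x = 0) ×ˢ
        (Finset.univ.filter fun x : ZMod q => x + x = 0)).card := by
    refine Finset.card_equiv (Equiv.funUnique (Fin 1) (ZMod q × ZMod q)) fun a => ?_
    simp [funext_iff, Prod.ext_iff]
  rw [Finset.card_product, card_add_self_eq_zero_of_even hq, h2,
    Finset.card_insert_of_notMem (by simp [orderTwo])] at h3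
  omega

theorem haarAverage_of_odd {d : ℝ} (hq : Odd q) (hd : d = (q : ℝ) ^ n) :
    haarAverage q n = 1 - 3 * (d ^ 4 - 4 * d ^ 2 + 2) / (d ^ 4 * (d ^ 2 - 4)) := by
  rw [haarAverage_eq hd (t := 0) (by rw [card_orderTwo_of_odd hq]; simp) rfl]
  have ho : Odd (q ^ n) := hq.pow
  have hd0 : d ≠ 0 := by rw [hd]; exact pow_ne_zero _ (NeZero.ne _)
  by_cases h1 : q ^ n = 1
  -- The factor `d² - 1` vanishes here and cannot be cancelled, so the value is computed directly.
  · have : d = 1 := by rw [hd]; exact_mod_cast h1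
    subst this
    norm_num
  · have h3 : (3 : ℝ) ≤ d := by
      rw [hd]
      have : 3 ≤ q ^ n := by obtain ⟨k, hk⟩ := ho; omega
      exact_mod_cast this
    have h1 : d ^ 2 - 1 ≠ 0 := by nlinarith
    have h4 : d ^ 2 - 4 ≠ 0 := by nlinarith
    field_simp
    ring

theorem haarAverage_one_of_even {d : ℝ} (hq : Even q) (hd : d = (q : ℝ)) :
    haarAverage q 1
      = 1 - 3 * (d ^ 4 - 10 * d ^ 2 + 10) / (d ^ 2 * (d ^ 2 - 9) * (d ^ 2 - 1)) := by
  rw [haarAverage_eq (d := d) (by rw [hd, pow_one]) (t := 3)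
    (by rw [card_orderTwo_one_of_even hq]; simp) rfl]
  have hq0 : q ≠ 0 := NeZero.ne q
  by_cases h2 : q = 2
  -- The denominator `d² - 4` vanishes here, but its weight `l = d² - 1 - 3` is zero.
  · have : d = 2 := by rw [hd, h2]; norm_num
    subst this
    norm_num
  · have h4 : (4 : ℝ) ≤ d := by
      rw [hd]
      have : 4 ≤ q := by obtain ⟨k, hk⟩ := hq; omega
      exact_mod_cast this
    have hd0 : d ≠ 0 := by linarith
    have h1 : d ^ 2 - 1 ≠ 0 := by nlinarith
    have h4 : d ^ 2 - 4 ≠ 0 := by nlinarith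
    have h9 : d ^ 2 - 9 ≠ 0 := by nlinarith
    field_simp
    ring

theorem haarAverage_two {d : ℝ} (hd : d = (2 : ℝ) ^ n) :
    haarAverage 2 n = 1 - 4 * (d ^ 4 - 9 * d ^ 2 + 6) / (d ^ 4 * (d ^ 2 - 9)) := by
  rw [haarAverage_eq (d := d) (by rw [hd]; norm_num) (t := d ^ 2 - 1)
    (by rw [card_orderTwo_two, hd]) (l := 0) (by ring)]
  have hd0 : d ≠ 0 := by rw [hd]; positivity
  by_cases h0 : n = 0
  · have : d = 1 := by rw [hd, h0]; norm_num
    subst this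
    norm_num
  · have h2 : (2 : ℝ) ≤ d := by
      rw [hd]; exact le_self_pow₀ (by norm_num) h0
    have h1 : d ^ 2 - 1 ≠ 0 := by nlinarith
    have h3 : d ≠ 3 := by
      rw [hd]
      have h : 2 ^ n ≠ 3 := fun h => by
        have : Even (2 ^ n) := (Nat.even_pow.mpr ⟨even_two, h0⟩)
        rw [h] at this
        exact absurd this (by decide)
      exact_mod_cast h
    have h9 : d ^ 2 - 9 ≠ 0 := by
      have : d ^ 2 - 9 = (d - 3) * (d + 3) := by ring
      rw [this]
      exact mul_ne_zero (sub_ne_zero.mpr h3) (by linarith)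
    field_simp
    ring

end Average

/-! ### The bound of order `d⁻²`. -/

section Asymptotics

/-- With `x = d²` the three fractions are asymptotic to `3/x`, `3/x` and `4/x`, so the constant 10
leaves ample room. The smallest dimensions, where a factor `d² - 4` or `d² - 9` is negative, are
evaluated numerically. -/
theorem abs_odd_le {d : ℝ} (hd : d = 1 ∨ 3 ≤ d) :
    |3 * (d ^ 4 - 4 * d ^ 2 + 2) / (d ^ 4 * (d ^ 2 - 4))| ≤ 10 / d ^ 2 := by
  rcases hd with rfl | hd
  · norm_num
  · have h9 : 9 ≤ d ^ 2 := by nlinarith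
    have e : d ^ 4 = d ^ 2 * d ^ 2 := by ring
    rw [e]
    generalize d ^ 2 = x at h9
    have hx : 0 < x := by linarith
    have h4 : 0 < x - 4 := by linarith
    have hn : 0 ≤ x * x - 4 * x + 2 := by nlinarith
    rw [abs_of_nonneg (by positivity), div_le_div_iff₀ (by positivity) hx]
    nlinarith [mul_pos hx hx, mul_pos hx h4, mul_nonneg (mul_pos hx hx).le (sub_nonneg.mpr h9)]

theorem abs_even_le {d : ℝ} (hd : d = 2 ∨ 4 ≤ d) :
    |3 * (d ^ 4 - 10 * d ^ 2 + 10) / (d ^ 2 * (d ^ 2 - 9) * (d ^ 2 - 1))| ≤ 10 / d ^ 2 := by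
  rcases hd with rfl | hd
  · norm_num [abs_le]
  · have h16 : 16 ≤ d ^ 2 := by nlinarith
    have e : d ^ 4 = d ^ 2 * d ^ 2 := by ring
    rw [e]
    generalize d ^ 2 = x at h16
    have hx : 0 < x := by linarith
    have h9 : 0 < x - 9 := by linarith
    have h1 : 0 < x - 1 := by linarith
    have hn : 0 ≤ x * x - 10 * x + 10 := by nlinarith
    rw [abs_of_nonneg (by positivity), div_le_div_iff₀ (by positivity) hx]
    nlinarith [mul_nonneg hx.le (mul_nonneg hx.le (sub_nonneg.mpr h16))]

theorem abs_two_le {d : ℝ} (hd : d = 1 ∨ d = 2 ∨ 4 ≤ d) :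
    |4 * (d ^ 4 - 9 * d ^ 2 + 6) / (d ^ 4 * (d ^ 2 - 9))| ≤ 10 / d ^ 2 := by
  rcases hd with rfl | rfl | hd
  · norm_num
  · norm_num [abs_le]
  · have h16 : 16 ≤ d ^ 2 := by nlinarith
    have e : d ^ 4 = d ^ 2 * d ^ 2 := by ring
    rw [e]
    generalize d ^ 2 = x at h16
    have hx : 0 < x := by linarith
    have h9 : 0 < x - 9 := by linarith
    have hn : 0 ≤ x * x - 9 * x + 6 := by nlinarith
    rw [abs_of_nonneg (by positivity), div_le_div_iff₀ (by positivity) hx]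
    nlinarith [mul_nonneg hx.le (mul_nonneg hx.le (sub_nonneg.mpr h16))]

theorem abs_one_sub_haarAverage_le (q n : ℕ) [NeZero q] (h : Odd q ∨ n = 1 ∨ q = 2) :
    |1 - haarAverage q n| ≤ 10 / ((q : ℝ) ^ n) ^ 2 := by
  by_cases hodd : Odd q
  · rw [haarAverage_of_odd hodd rfl, sub_sub_cancel]
    refine abs_odd_le ?_
    have ho : Odd (q ^ n) := hodd.pow
    have : q ^ n = 1 ∨ 3 ≤ q ^ n := by obtain ⟨k, hk⟩ := ho; omega
    exact_mod_cast this
  · rcases h with h | rfl | rfl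
    · exact absurd h hodd
    · have heven := Nat.not_odd_iff_even.mp hodd
      rw [haarAverage_one_of_even heven rfl, sub_sub_cancel, pow_one]
      refine abs_even_le ?_
      have hq0 : q ≠ 0 := NeZero.ne q
      have : q = 2 ∨ 4 ≤ q := by obtain ⟨k, hk⟩ := heven; omega
      exact_mod_cast this
    · rw [haarAverage_two rfl, sub_sub_cancel, Nat.cast_ofNat]
      refine abs_two_le ?_
      rcases n with _ | _ | n
      · simp
      · simp
      · right; right
        have : (1 : ℝ) ≤ 2 ^ n := one_le_pow₀ (by norm_num)
        rw [pow_add, pow_add]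
        linarith

end Asymptotics

end CliffordEntropy

end

theorem mainTheorem8 :
    -- odd dimension `d = q ^ n`, for `n` qudits of odd local dimension `q` (`n = 1`: one qudit)
    (∀ (q n : ℕ) [NeZero q] (d : ℝ), Odd q → d = (q : ℝ) ^ n →
      CliffordEntropy.haarAverage q n
        = 1 - 3 * (d ^ 4 - 4 * d ^ 2 + 2) / (d ^ 4 * (d ^ 2 - 4))) ∧
    -- even dimension `d = q`, for one qudit
    (∀ (q : ℕ) [NeZero q] (d : ℝ), Even q → d = (q : ℝ) →
      CliffordEntropy.haarAverage q 1
        = 1 - 3 * (d ^ 4 - 10 * d ^ 2 + 10) / (d ^ 2 * (d ^ 2 - 9) * (d ^ 2 - 1))) ∧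
    -- dimension `d = 2 ^ n`, for `n` qubits
    (∀ (n : ℕ) (d : ℝ), d = (2 : ℝ) ^ n →
      CliffordEntropy.haarAverage 2 n
        = 1 - 4 * (d ^ 4 - 9 * d ^ 2 + 6) / (d ^ 4 * (d ^ 2 - 9))) ∧
    -- in each of these cases the average is `1 - O(d⁻²)`, with one absolute constant
    (∃ C : ℝ, ∀ (q n : ℕ) [NeZero q], (Odd q ∨ n = 1 ∨ q = 2) →
      |1 - CliffordEntropy.haarAverage q n| ≤ C / ((q : ℝ) ^ n) ^ 2) :=
  ⟨fun _ _ _ _ hq hd => CliffordEntropy.haarAverage_of_odd hq hd,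
    fun _ _ _ hq hd => CliffordEntropy.haarAverage_one_of_even hq hd,
    fun _ _ hd => CliffordEntropy.haarAverage_two hd,
    10, fun q n _ h => CliffordEntropy.abs_one_sub_haarAverage_le q n h⟩
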